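/- Let $d\ge 1$ and let $\{(\mathbf A_n,\mathbf b_n)\}_{n\ge 1}$ be i.i.d. random variables with values in $\mathbb R^{d\times d}\times\mathbb R^d$ such that: (i) $\mathbb E[\mathbf b_1]=\bar b$ and there is $C_b>0$ such that for every $u\in\mathbb R^d$ with $\|u\|=1$ and every $\lambda\in\mathbb R$, $\log\mathbb E[e^{\lambda u^\top(\mathbf b_1-\bar b)}]\le\lambda^2C_b^2/2$; (ii) $\|\mathbf A_1\|\le C_A$ almost surely for some $C_A>0$, where $\|\cdot\|$ is the spectral norm; (iii) every eigenvalue of $\bar A=\mathbb E[\mathbf A_1]$ has positive real part. Let $Q$ be the unique symmetric positive definite matrix with $\bar A^\top Q+Q\bar A=\mathrm I$ (it exists and is unique under (iii)), and put $\|x\|_Q=(x^\top Qx)^{1/2}$, $\|M\|_Q=\max_{\|x\|_Q=1}\|Mx\|_Q$, $\kappa_Q=\lambda_{\max}(Q)/\lambda_{\min}(Q)$, $a=\|Q\|^{-1}/2$, $b_Q=2\sqrt{\kappa_Q}\,C_A$, $\alpha_\infty=\tfrac12\|\bar A\|_Q^{-2}\|Q\|^{-1}$ and $\alpha_{2,\infty}=\min\{\alpha_\infty,\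 a/(2b_Q^2)\}$. For $\alpha>0$ let $R_\alpha$ be the Markov kernel of the recursion $\theta_{n+1}=\theta_n-\alpha(\mathbf A_{n+1}\theta_n-\mathbf b_{n+1})$, that is, $R_\alpha(\theta,\cdot)$ is the law of $\theta-\alpha(\mathbf A_1\theta-\mathbf b_1)$. Let $\mathcal P_2(\mathbb R^d)$ be the set of probability measures with finite second moment and $W_2(\mu,\nu)=\big(\inf_\zeta\int\|x-y\|^2\,d\zeta(x,y)\big)^{1/2}$, the infimum over all couplings $\zeta$ of $\mu$ and $\nu$. Then, for every $\alpha\in(0,\alpha_{2,\infty})$, $R_\alpha$ has a unique stationary probability measure $\pi_\alpha$, it belongs to $\mathcal P_2(\mathbb R^d)$, and for all $\theta\in\mathbb R^d$ and $n\in\mathbb N$, $$W_2^2(\delta_\theta R_\alpha^n,\pi_\alpha)\ \le\ \kappa_Q\,d\,(1-a\alpha/2)^n\int_{\mathbb R^d}\|\tilde\theta-\theta\|^2\,d\pi_\alpha(\tilde\theta).$$ Moreover, if $\{(\mathbf A_k,\mathbf b_k)\}_{k\in\mathbb Z,\,k\le 0}$ is any i.i.d. sequence with the same distribution as $(\mathbf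 A_1,\mathbf b_1)$ (on any probability space), then, with $\Gamma_{k:0}=(\mathrm I-\alpha\mathbf A_0)(\mathrm I-\alpha\mathbf A_{-1})\cdots(\mathrm I-\alpha\mathbf A_k)$ for $k\le 0$ and $\Gamma_{1:0}=\mathrm I$, the limit $$\theta_\infty^{(\alpha)}=\lim_{n\to-\infty}\ \alpha\sum_{k=n}^{1}\Gamma_{k:0}\,\mathbf b_{k-1}$$ exists almost surely and in $\mathrm L^2$, and $\theta_\infty^{(\alpha)}$ has distribution $\pi_\alpha$. -/

import Mathlib

universe u v

open MeasureTheory ProbabilityTheory Filter Topology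
open scoped ENNReal NNReal Matrix Matrix.Norms.L2Operator

/-- `ℝ^d` with its Euclidean norm. -/
abbrev Vec (d : ℕ) : Type := EuclideanSpace ℝ (Fin d)

/-- Real `d × d` matrices. The norm `‖M‖` of a matrix is the spectral norm (operator norm for the
Euclidean norm), made available by the scope `Matrix.Norms.L2Operator`. -/
abbrev Mat (d : ℕ) : Type := Matrix (Fin d) (Fin d) ℝ

/-- Matrices carry the Borel sigma-algebra. -/
instance matMeasurableSpace (d : ℕ) : MeasurableSpace (Mat d) := borel (Mat d)

instance matBorelSpace (d : ℕ) : BorelSpace (Mat d) := ⟨rfl⟩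

instance matSecondCountable (d : ℕ) : SecondCountableTopology (Mat d) :=
  inferInstanceAs (SecondCountableTopology (Fin d → Fin d → ℝ))

/-- The matrix-vector product `M x`, as a vector of the Euclidean space. -/
noncomputable def act {d : ℕ} (M : Mat d) (x : Vec d) : Vec d := WithLp.toLp 2 (M *ᵥ x.ofLp)

/-! ### Constants attached to the mean matrix -/

/-- `-M` is Hurwitz: every complex eigenvalue of `M` has positive real part. -/
def NegHurwitz {d : ℕ} (M : Mat d) : Prop :=
  ∀ z : ℂ, Module.End.HasEigenvalue (Matrix.toLin' (M.map (fun t : ℝ => (t : ℂ)))) z → 0 < z.re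

/-- `Q` is a symmetric positive definite solution of the Lyapunov equation
`Mᵀ Q + Q M = I`. -/
def IsLyapunovSolution {d : ℕ} (M Q : Mat d) : Prop :=
  Q.PosDef ∧ Mᵀ * Q + Q * M = 1

/-- `‖x‖_Q = (xᵀ Q x)^{1/2}`. -/
noncomputable def normQ {d : ℕ} (Q : Mat d) (x : Vec d) : ℝ :=
  Real.sqrt (x.ofLp ⬝ᵥ (Q *ᵥ x.ofLp))

/-- `‖M‖_Q = max {‖M x‖_Q : ‖x‖_Q = 1}`. -/
noncomputable def opNormQ {d : ℕ} (Q M : Mat d) : ℝ :=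
  sSup {r : ℝ | ∃ x : Vec d, normQ Q x = 1 ∧ r = normQ Q (act M x)}

/-- The condition number `λ_max(Q) / λ_min(Q)`; the spectrum of a matrix is its set of
eigenvalues. -/
noncomputable def condNumber {d : ℕ} (Q : Mat d) : ℝ :=
  sSup (spectrum ℝ Q) / sInf (spectrum ℝ Q)

/-- `a = ‖Q‖⁻¹ / 2`. -/
noncomputable def rateConst {d : ℕ} (Q : Mat d) : ℝ := ‖Q‖⁻¹ / 2

/-- `α_∞ = (1/2) ‖M‖_Q⁻² ‖Q‖⁻¹`. -/
noncomputable def alphaInfty {d : ℕ} (M Q : Mat d) : ℝ :=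
  (1 / 2) * (opNormQ Q M ^ 2)⁻¹ * ‖Q‖⁻¹

/-- `b_Q = 2 κ_Q^{1/2} C_A`. -/
noncomputable def bQ {d : ℕ} (Q : Mat d) (CA : ℝ) : ℝ := 2 * Real.sqrt (condNumber Q) * CA

/-- `α_{p,∞} = min (α_∞, a / (2 b_Q² (p - 1)))`. -/
noncomputable def alphaP {d : ℕ} (M Q : Mat d) (CA p : ℝ) : ℝ :=
  min (alphaInfty M Q) (rateConst Q / (2 * bQ Q CA ^ 2 * (p - 1)))

/-! ### The noise assumption -/

/-- The pairs `(A k, b k)`, `k ∈ ι`, are random variables that are independent and identically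
distributed. -/
structure IsIID {d : ℕ} {ι Ω : Type*} [MeasurableSpace Ω] (μ : Measure Ω)
    (A : ι → Ω → Mat d) (b : ι → Ω → Vec d) : Prop where
  measurable_A : ∀ k, Measurable (A k)
  measurable_b : ∀ k, Measurable (b k)
  indep : iIndepFun (fun k ω => (A k ω, b k ω)) μ
  ident : ∀ k l, IdentDistrib (fun ω => (A k ω, b k ω)) (fun ω => (A l ω, b l ω)) μ μ

/-- The standing assumption on the sequence `(A_n, b_n)_{n ≥ 1}`, with the constants `C_b` and
`C_A`: the sequence is i.i.d.; `b_1` is integrable and every `uᵀ (b_1 - E b_1)` with `‖u‖ = 1` is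
sub-Gaussian with variance factor `C_b²`; `‖A_1‖ ≤ C_A` almost surely; and `-E A_1` is Hurwitz. -/
structure NoiseAssumption {d : ℕ} {Ω : Type*} [MeasurableSpace Ω] (μ : Measure Ω)
    (A : ℕ+ → Ω → Mat d) (b : ℕ+ → Ω → Vec d) (Cb CA : ℝ≥0) : Prop where
  iid : IsIID μ A b
  Cb_pos : 0 < Cb
  integrable_b : Integrable (b 1) μ
  subGaussian : ∀ u : Vec d, ‖u‖ = 1 →
    HasSubgaussianMGF (fun ω => inner ℝ u (b 1 ω - ∫ ω', b 1 ω' ∂μ)) (Cb ^ 2) μ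
  CA_pos : 0 < CA
  bounded_A : ∀ᵐ ω ∂μ, ‖A 1 ω‖ ≤ CA
  hurwitz : NegHurwitz (∫ ω, A 1 ω ∂μ)

/-! ### The Markov kernel -/

/-- One step `θ - α (A θ - b)` of the recursion, with noise `p = (A, b)`. -/
noncomputable def lsaStep {d : ℕ} (α : ℝ) (θ : Vec d) (p : Mat d × Vec d) : Vec d :=
  θ - α • (act p.1 θ - p.2)

theorem measurable_act {d : ℕ} : Measurable (fun q : Mat d × Vec d => act q.1 q.2) := by
  apply Continuous.measurable
  unfold act
  refine (PiLp.continuous_toLp 2 _).comp ?_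
  exact continuous_fst.matrix_mulVec ((PiLp.continuous_ofLp 2 _).comp continuous_snd)

theorem measurable_lsaStep {d : ℕ} (α : ℝ) :
    Measurable (fun q : Vec d × (Mat d × Vec d) => lsaStep α q.1 q.2) := by
  unfold lsaStep
  have h : Measurable (fun q : Vec d × (Mat d × Vec d) => act q.2.1 q.1) :=
    measurable_act.comp ((measurable_fst.comp measurable_snd).prodMk measurable_fst)
  exact measurable_fst.sub ((h.sub (measurable_snd.comp measurable_snd)).const_smul α)

/-- The kernel `R_α` of the recursion `θ_{n+1} = θ_n - α (A_{n+1} θ_n - b_{n+1})`, where `ν` is the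
law of the noise `(A_1, b_1)`: `R_α(θ, ·)` is the law of `θ - α (A_1 θ - b_1)`. -/
noncomputable def lsaKernel {d : ℕ} (ν : Measure (Mat d × Vec d)) [SFinite ν] (α : ℝ) :
    Kernel (Vec d) (Vec d) where
  toFun θ := ν.map (lsaStep α θ)
  measurable' := by
    have h : (fun θ : Vec d => ν.map (lsaStep α θ)) =
        fun θ => (ν.map (Prod.mk θ)).map (fun q : Vec d × (Mat d × Vec d) => lsaStep α q.1 q.2) := by
      funext θ
      rw [Measure.map_map (measurable_lsaStep α) measurable_prodMk_left]
      rfl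
    rw [h]
    exact (Measure.measurable_map _ (measurable_lsaStep α)).comp Measurable.map_prodMk_left

/-! ### Square-integrable probability measures and the Wasserstein distance -/

/-- `π ∈ P₂(ℝ^d)`: a probability measure with finite second moment. -/
def IsP2 {d : ℕ} (π : Measure (Vec d)) : Prop :=
  IsProbabilityMeasure π ∧ ∫⁻ x, ‖x‖ₑ ^ 2 ∂π < ∞

/-- `ζ` is a coupling of `μ` and `ν`: a measure on the product with marginals `μ` and `ν`. -/
def IsCoupling {d : ℕ} (ζ : Measure (Vec d × Vec d)) (μ ν : Measure (Vec d)) : Prop :=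
  ζ.map Prod.fst = μ ∧ ζ.map Prod.snd = ν

/-- The Wasserstein distance of order two of two probability measures,
`W₂(μ, ν) = (inf_ζ ∫ ‖x - y‖² dζ(x, y))^{1/2}` over all couplings `ζ`, with values in `[0, ∞]`. -/
noncomputable def W2 {d : ℕ} (μ ν : Measure (Vec d)) : ℝ≥0∞ :=
  (⨅ (ζ : Measure (Vec d × Vec d)) (_ : IsCoupling ζ μ ν),
    ∫⁻ p, ‖p.1 - p.2‖ₑ ^ 2 ∂ζ) ^ (1 / 2 : ℝ)

/-! ### The backward iteration

A sequence indexed by the nonpositive integers is written as a sequence indexed by `ℕ`: the entry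
with number `j` is the one with index `-j`. -/

/-- `Γ_{k:0} = (I - α A_0) (I - α A_{-1}) ⋯ (I - α A_k)` for `k = 1 - j`, a product of `j`
factors; it is the identity for `j = 0`, that is, for `k = 1`. -/
noncomputable def backProd {d : ℕ} {Ω : Type*} (α : ℝ) (A : ℕ → Ω → Mat d) (ω : Ω) : ℕ → Mat d
  | 0 => 1
  | j + 1 => backProd α A ω j * (1 - α • A j ω)

/-- `α ∑_{k=n}^{1} Γ_{k:0} b_{k-1}` for `n = 1 - m`: the term with index `k = 1 - j` is
`Γ_{1-j:0} b_{-j}`, and `j` runs through `0, …, m`. -/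
noncomputable def backIter {d : ℕ} {Ω : Type*} (α : ℝ) (A : ℕ → Ω → Mat d) (b : ℕ → Ω → Vec d)
    (m : ℕ) (ω : Ω) : Vec d :=
  α • ∑ j ∈ Finset.range (m + 1), act (backProd α A ω j) (b j ω)

/-! ### The Lyapunov equation -/

/-! Write q(x) = xᵀQx. By the Lyapunov equation, E q(x - αAx) = q(x) - α‖x‖² + α² E q(Ax). The
linear term gains at least 2aα q(x), and for small α the quadratic term is only a fraction of this,
so one step contracts q in mean by ρ = 1 - aα/2 (`integral_quadForm_le`). Peeling independent
factors off the random product Γ gives E‖Γ_n v‖² ≤ κ_Q ρ^n E‖v‖²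
(`MeanSquareContracting.lintegral_enorm_sq_le`), where v may depend on the noise that follows the n
factors.

The rest is the backward-iteration argument. With the order of the noise reversed, n steps started
at x still have law R_α^n(x, ·), but now they are partial sums of a series with geometrically small
L² terms, plus Γ_n x → 0. They converge almost surely to a limit S that does not depend on x. One
more independent step shows that the law of S is stationary. A start drawn from any stationary law
keeps that law while the iterates converge to S, which gives uniqueness. Driving two starts by the
same noise makes their difference Γ_n(x - y), and this coupling bounds W₂.

Existence of Q comes from the Cayley transform C = (1 - M)(1 + M)⁻¹, which turns the Lyapunov
operator into X ↦ X - CᵀXC with Cⁿ → 0. -/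

theorem tendsto_pow_zero_of_spectralRadius_lt_one {R : Type*} [NormedRing R] [NormedAlgebra ℂ R]
    [CompleteSpace R] {x : R} (hx : spectralRadius ℂ x < 1) :
    Tendsto (fun n : ℕ => x ^ n) atTop (𝓝 0) := by
  obtain ⟨r, hr, hr1⟩ := ENNReal.lt_iff_exists_nnreal_btwn.mp hx
  have hr1' : r < 1 := by exact_mod_cast hr1
  have hev := (spectrum.pow_nnnorm_pow_one_div_tendsto_nhds_spectralRadius x).eventually_lt_const hr
  apply squeeze_zero_norm' (a := fun n : ℕ => (r : ℝ) ^ n) _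
    (tendsto_pow_atTop_nhds_zero_of_lt_one r.2 (by exact_mod_cast hr1'))
  filter_upwards [hev, eventually_gt_atTop 0] with n hn hn0
  have h1 : (‖x ^ n‖₊ : ℝ≥0∞) ≤ (r : ℝ≥0∞) ^ n := by
    have h2 := ENNReal.rpow_le_rpow hn.le (z := (n : ℝ)) (by positivity)
    rw [← ENNReal.rpow_mul, one_div, inv_mul_cancel₀ (by positivity), ENNReal.rpow_one,
      ENNReal.rpow_natCast] at h2
    exact h2
  exact_mod_cast h1

theorem NegHurwitz.isUnit_one_add {d : ℕ} {M : Mat d} (hM : NegHurwitz M) : IsUnit (1 + M) := by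
  rw [Matrix.isUnit_iff_isUnit_det, isUnit_iff_ne_zero]
  intro h0
  have hsp : (-1 : ℂ) ∈ spectrum ℂ (M.map (fun t : ℝ => (t : ℂ))) := by
    rw [spectrum.mem_iff, Matrix.isUnit_iff_isUnit_det, isUnit_iff_ne_zero, not_not]
    have h1 : (algebraMap ℂ (Matrix (Fin d) (Fin d) ℂ) (-1) - M.map (fun t : ℝ => (t : ℂ)))
        = -((1 + M).map Complex.ofRealHom) := by
      rw [Matrix.map_add _ (map_add _), Matrix.map_one _ (map_zero _) (map_one _)]
      rw [map_neg, map_one, neg_add]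
      rfl
    rw [h1, Matrix.det_neg, ← RingHom.mapMatrix_apply, ← RingHom.map_det, h0]
    simp
  rw [← Matrix.spectrum_toLin', ← Module.End.hasEigenvalue_iff_mem_spectrum] at hsp
  have := hM _ hsp
  norm_num at this

/-- The Cayley transform `(1 - M) (1 + M)⁻¹`. -/
noncomputable def cayley {d : ℕ} (M : Mat d) : Mat d := (1 - M) * (1 + M)⁻¹

/-- The map z ↦ (1 - z)/(1 + z) is an involution that exchanges the right half-plane and the unit
disc, so all eigenvalues of the transform lie in the open disc. Gelfand's formula then gives the
decay of the powers. -/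
theorem NegHurwitz.tendsto_cayley_pow {d : ℕ} {M : Mat d} (hM : NegHurwitz M) :
    Tendsto (fun n : ℕ => cayley M ^ n) atTop (𝓝 0) := by
  rcases Nat.eq_zero_or_pos d with rfl | hd
  · rw [show (fun n : ℕ => cayley M ^ n) = fun _ => 0 from funext fun n => Subsingleton.elim _ _]
    exact tendsto_const_nhds
  have : Nonempty (Fin d) := ⟨⟨0, hd⟩⟩
  have : Nontrivial (Matrix (Fin d) (Fin d) ℂ) := inferInstance
  have hu := hM.isUnit_one_add
  set F := (Complex.ofRealHom).mapMatrix (m := Fin d) with hF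
  have hMF : M.map (fun t : ℝ => (t : ℂ)) = F M := rfl
  have hCF : F (cayley M) * (1 + F M) = 1 - F M := by
    rw [← map_one F, ← map_add, ← map_mul, ← map_sub, cayley, mul_assoc,
      Matrix.nonsing_inv_mul _ ((Matrix.isUnit_iff_isUnit_det _).mp hu), mul_one]
  have huF : IsUnit (1 + F M) := by
    rw [← map_one F, ← map_add]
    exact hu.map F
  have hlim : Tendsto (fun n : ℕ => F (cayley M) ^ n) atTop (𝓝 0) := by
    apply tendsto_pow_zero_of_spectralRadius_lt_one
    have : spectralRadius ℂ (F (cayley M)) < (1 : ℝ≥0) := by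
      apply spectrum.spectralRadius_lt_of_forall_lt
      intro w hw
      have key : (algebraMap ℂ (Matrix (Fin d) (Fin d) ℂ) w - F (cayley M)) * (1 + F M)
          = algebraMap ℂ _ (w - 1) + algebraMap ℂ _ (w + 1) * F M := by
        rw [sub_mul, hCF]
        simp only [map_sub, map_add, map_one]
        noncomm_ring
      have hnu : ¬ IsUnit (algebraMap ℂ (Matrix (Fin d) (Fin d) ℂ) (w - 1)
          + algebraMap ℂ _ (w + 1) * F M) := by
        rw [← key]
        intro h
        apply spectrum.mem_iff.mp hw
        have := h.mul huF.unit⁻¹.isUnit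
        rwa [mul_assoc, IsUnit.mul_val_inv, mul_one] at this
      -- For w = -1 the right side of `key` would be the invertible scalar -2.
      have hw1 : w + 1 ≠ 0 := by
        intro h
        apply hnu
        rw [h, map_zero, zero_mul, add_zero]
        refine (IsUnit.mk0 (w - 1) ?_).map (algebraMap ℂ (Matrix (Fin d) (Fin d) ℂ))
        rw [eq_neg_of_add_eq_zero_left h]
        norm_num
      have hz : (1 - w) / (w + 1) ∈ spectrum ℂ (F M) := by
        rw [spectrum.mem_iff]
        intro h
        apply hnu
        have h2 := ((IsUnit.mk0 _ (neg_ne_zero.mpr hw1)).map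
          (algebraMap ℂ (Matrix (Fin d) (Fin d) ℂ))).mul h
        rw [mul_sub, ← map_mul, mul_div_assoc', mul_comm (-(w + 1)), mul_div_assoc, neg_div,
          div_self hw1] at h2
        convert h2 using 1
        rw [map_neg, neg_mul, sub_neg_eq_add, mul_neg_one, neg_sub]
      rw [← hMF, ← Matrix.spectrum_toLin', ← Module.End.hasEigenvalue_iff_mem_spectrum] at hz
      have hre := hM _ hz
      rw [Complex.div_re, ← add_div] at hre
      have hpos : 0 < Complex.normSq (w + 1) := Complex.normSq_pos.mpr hw1
      have hre' := (div_pos_iff_of_pos_right hpos).mp hre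
      simp at hre'
      have hsq : ‖w‖ ^ 2 < 1 := by
        rw [← Complex.normSq_eq_norm_sq, Complex.normSq_apply]
        nlinarith
      have : ‖w‖ < 1 := by
        by_contra hcon
        nlinarith [norm_nonneg w]
      exact_mod_cast this
    simpa using this
  -- Back to real matrices: the real entries are the real parts of the complex ones.
  refine tendsto_pi_nhds.mpr fun i => tendsto_pi_nhds.mpr fun j => ?_
  have hi : Tendsto (fun n : ℕ => (F (cayley M) ^ n) i j) atTop (𝓝 0) :=
    tendsto_pi_nhds.mp (tendsto_pi_nhds.mp hlim i) j
  have hij := (Complex.continuous_re.tendsto _).comp hi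
  refine (hij.congr fun n => ?_)
  rw [Function.comp_apply, ← map_pow]
  simp [hF]

theorem NegHurwitz.cayley_mul {d : ℕ} {M : Mat d} (hM : NegHurwitz M) :
    cayley M * (1 + M) = 1 - M := by
  rw [cayley, mul_assoc, Matrix.nonsing_inv_mul _
    ((Matrix.isUnit_iff_isUnit_det _).mp hM.isUnit_one_add), mul_one]

/-- Congruence by the invertible matrix 1 + M carries the discrete operator X - CᵀXC to the Lyapunov
operator, so the latter can be studied by iterating C. -/
theorem NegHurwitz.conj_cayley_sub {d : ℕ} {M : Mat d} (hM : NegHurwitz M) (X : Mat d) :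
    (1 + M)ᵀ * (X - (cayley M)ᵀ * X * cayley M) * (1 + M) = (2 : ℝ) • (Mᵀ * X + X * M) := by
  have h := hM.cayley_mul
  have hT : (1 + M)ᵀ * (cayley M)ᵀ = (1 - M)ᵀ := by rw [← Matrix.transpose_mul, h]
  have : (1 + M)ᵀ * (X - (cayley M)ᵀ * X * cayley M) * (1 + M)
      = (1 + M)ᵀ * X * (1 + M) - ((1 + M)ᵀ * (cayley M)ᵀ) * X * (cayley M * (1 + M)) := by
    noncomm_ring
  rw [this, hT, h, two_smul]
  simp only [Matrix.transpose_add, Matrix.transpose_sub, Matrix.transpose_one]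
  noncomm_ring

/-- In discrete form X = CᵀXC; iterating, X = (Cⁿ)ᵀXCⁿ → 0. -/
theorem NegHurwitz.eq_zero_of_lyapunov_eq_zero {d : ℕ} {M : Mat d} (hM : NegHurwitz M) {X : Mat d}
    (hX : Mᵀ * X + X * M = 0) : X = 0 := by
  have hu := hM.isUnit_one_add
  have h1 := hM.conj_cayley_sub X
  rw [hX, smul_zero] at h1
  have huT : IsUnit (1 + M)ᵀ := (Matrix.isUnit_transpose _).mpr hu
  have h2 : X = (cayley M)ᵀ * X * cayley M := by
    rw [hu.mul_left_eq_zero, huT.mul_right_eq_zero] at h1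
    exact sub_eq_zero.mp h1
  have h3 : ∀ n : ℕ, X = (cayley M ^ n)ᵀ * X * cayley M ^ n := by
    intro n
    induction n with
    | zero => simp
    | succ n ih =>
      rw [pow_succ, Matrix.transpose_mul]
      conv_lhs => rw [h2, ih]
      noncomm_ring
  have hc := hM.tendsto_cayley_pow
  have hT : Tendsto (fun n : ℕ => (cayley M ^ n)ᵀ) atTop (𝓝 (0 : Mat d)ᵀ) :=
    ((continuous_id.matrix_transpose).tendsto _).comp hc
  have h4 := (hT.mul_const X).mul hc
  rw [Matrix.transpose_zero, mul_zero] at h4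
  exact tendsto_nhds_unique (tendsto_const_nhds.congr h3) h4

/-- The Lyapunov operator `X ↦ Mᵀ X + X M`. -/
noncomputable def lyapunovMap {d : ℕ} (M : Mat d) : Mat d →ₗ[ℝ] Mat d :=
  LinearMap.mulLeft ℝ Mᵀ + LinearMap.mulRight ℝ M

theorem lyapunovMap_apply {d : ℕ} (M X : Mat d) : lyapunovMap M X = Mᵀ * X + X * M := rfl

theorem NegHurwitz.injective_lyapunovMap {d : ℕ} {M : Mat d} (hM : NegHurwitz M) :
    Function.Injective (lyapunovMap M) := by
  rw [injective_iff_map_eq_zero]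
  exact fun X hX => hM.eq_zero_of_lyapunov_eq_zero hX

/-- Qᵀ solves the same equation, so Q is symmetric. With y = (1 + M)⁻¹x, the discrete form reads
q(x) = q(Cx) + 2|y|². Hence q decreases along Cⁿx → 0, so q ≥ 0, and one more use of the identity
makes it strict for x ≠ 0. -/
theorem NegHurwitz.posDef_of_lyapunov {d : ℕ} {M : Mat d} (hM : NegHurwitz M) {Q : Mat d}
    (hQ : Mᵀ * Q + Q * M = 1) : Q.PosDef := by
  have hu := hM.isUnit_one_add
  have hsymm : Qᵀ = Q := by
    apply hM.injective_lyapunovMap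
    rw [lyapunovMap_apply, lyapunovMap_apply, hQ, add_comm]
    have := congrArg Matrix.transpose hQ
    simpa using this
  have hstep : ∀ x : Fin d → ℝ, ∃ y : Fin d → ℝ, (y = 0 → x = 0) ∧
      x ⬝ᵥ (Q *ᵥ x) = (cayley M *ᵥ x) ⬝ᵥ (Q *ᵥ (cayley M *ᵥ x)) + 2 * (y ⬝ᵥ y) := by
    intro x
    refine ⟨(1 + M)⁻¹ *ᵥ x, ?_, ?_⟩
    · intro h
      have : (1 + M) *ᵥ ((1 + M)⁻¹ *ᵥ x) = 0 := by rw [h, Matrix.mulVec_zero]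
      rwa [Matrix.mulVec_mulVec, Matrix.mul_nonsing_inv _
        ((Matrix.isUnit_iff_isUnit_det _).mp hu), Matrix.one_mulVec] at this
    · set y := (1 + M)⁻¹ *ᵥ x with hy
      have hx : x = (1 + M) *ᵥ y := by
        rw [hy, Matrix.mulVec_mulVec, Matrix.mul_nonsing_inv _
          ((Matrix.isUnit_iff_isUnit_det _).mp hu), Matrix.one_mulVec]
      have h1 := hM.conj_cayley_sub Q
      rw [hQ] at h1
      have h2 : y ⬝ᵥ (((1 + M)ᵀ * (Q - (cayley M)ᵀ * Q * cayley M) * (1 + M)) *ᵥ y)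
          = 2 * (y ⬝ᵥ y) := by
        rw [h1, Matrix.smul_mulVec, Matrix.one_mulVec, dotProduct_smul, smul_eq_mul]
      rw [← Matrix.mulVec_mulVec, ← Matrix.mulVec_mulVec, ← hx, Matrix.dotProduct_mulVec,
        Matrix.vecMul_transpose, ← hx, Matrix.sub_mulVec, dotProduct_sub,
        ← Matrix.mulVec_mulVec, ← Matrix.mulVec_mulVec, Matrix.dotProduct_mulVec x (cayley M)ᵀ,
        Matrix.vecMul_transpose] at h2
      linarith
  have hnn : ∀ x : Fin d → ℝ, 0 ≤ x ⬝ᵥ (Q *ᵥ x) := by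
    intro x
    have hmono : ∀ n : ℕ,
        (cayley M ^ n *ᵥ x) ⬝ᵥ (Q *ᵥ (cayley M ^ n *ᵥ x)) ≤ x ⬝ᵥ (Q *ᵥ x) := by
      intro n
      induction n with
      | zero => simp
      | succ n ih =>
        refine le_trans ?_ ih
        obtain ⟨y, -, hy⟩ := hstep (cayley M ^ n *ᵥ x)
        rw [hy, pow_succ', ← Matrix.mulVec_mulVec]
        have : 0 ≤ y ⬝ᵥ y := by simpa using dotProduct_star_self_nonneg y
        linarith
    have hc : Continuous fun C : Mat d => (C *ᵥ x) ⬝ᵥ (Q *ᵥ (C *ᵥ x)) := by fun_prop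
    have hlim := (hc.tendsto 0).comp hM.tendsto_cayley_pow
    simp only [Matrix.zero_mulVec, zero_dotProduct] at hlim
    exact le_of_tendsto hlim (Eventually.of_forall hmono)
  refine Matrix.PosDef.of_dotProduct_mulVec_pos (by simpa [Matrix.IsHermitian] using hsymm) ?_
  intro x hx
  obtain ⟨y, hy0, hy⟩ := hstep x
  have h1 : 0 < y ⬝ᵥ y := by
    simpa using Matrix.dotProduct_star_self_pos_iff.mpr (fun h => hx (hy0 h))
  have h2 := hnn (cayley M *ᵥ x)
  rw [star_trivial, hy]
  linarith

/-- In finite dimension the injective Lyapunov operator is surjective, so uniqueness yields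
existence. -/
theorem NegHurwitz.exists_unique_lyapunov {d : ℕ} {M : Mat d} (hM : NegHurwitz M) :
    ∃ Q : Mat d, IsLyapunovSolution M Q ∧ ∀ Q' : Mat d, IsLyapunovSolution M Q' → Q' = Q := by
  obtain ⟨Q, hQ⟩ := LinearMap.surjective_of_injective hM.injective_lyapunovMap 1
  rw [lyapunovMap_apply] at hQ
  refine ⟨Q, ⟨hM.posDef_of_lyapunov hQ, hQ⟩, fun Q' hQ' => hM.injective_lyapunovMap ?_⟩
  rw [lyapunovMap_apply, lyapunovMap_apply, hQ, hQ'.2]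

/-! ### The action of matrices on vectors and the quadratic form `xᵀ Q x` -/

@[simp] theorem ofLp_act {d : ℕ} (M : Mat d) (x : Vec d) : (act M x).ofLp = M *ᵥ x.ofLp := rfl

theorem act_sub {d : ℕ} (M : Mat d) (x y : Vec d) : act M (x - y) = act M x - act M y := by
  ext i; simp [Matrix.mulVec_sub]

theorem act_add {d : ℕ} (M : Mat d) (x y : Vec d) : act M (x + y) = act M x + act M y := by
  ext i; simp [Matrix.mulVec_add]

theorem act_smul {d : ℕ} (M : Mat d) (c : ℝ) (x : Vec d) : act M (c • x) = c • act M x := by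
  ext i; simp [Matrix.mulVec_smul]

theorem act_one {d : ℕ} (x : Vec d) : act 1 x = x := by ext i; simp

theorem act_mul {d : ℕ} (M N : Mat d) (x : Vec d) : act (M * N) x = act M (act N x) := by
  ext i; simp [Matrix.mulVec_mulVec]

theorem act_one_sub_smul {d : ℕ} (α : ℝ) (M : Mat d) (x : Vec d) :
    act (1 - α • M) x = x - α • act M x := by
  ext i; simp [Matrix.sub_mulVec, Matrix.smul_mulVec]

theorem norm_act_le {d : ℕ} (M : Mat d) (x : Vec d) : ‖act M x‖ ≤ ‖M‖ * ‖x‖ :=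
  M.l2_opNorm_mulVec x

theorem continuous_act {d : ℕ} (M : Mat d) : Continuous (act M) := by
  unfold act
  exact (PiLp.continuous_toLp 2 _).comp
    (continuous_const.matrix_mulVec (PiLp.continuous_ofLp 2 _))

theorem inner_eq_dotProduct {d : ℕ} (x y : Vec d) : inner ℝ x y = x.ofLp ⬝ᵥ y.ofLp := by
  rw [EuclideanSpace.inner_eq_star_dotProduct, star_trivial, dotProduct_comm]

theorem dotProduct_self_eq_norm_sq {d : ℕ} (x : Vec d) : x.ofLp ⬝ᵥ x.ofLp = ‖x‖ ^ 2 := by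
  rw [← inner_eq_dotProduct, real_inner_self_eq_norm_sq]

/-- The quadratic form `xᵀ Q x`. -/
noncomputable def quadForm {d : ℕ} (Q : Mat d) (x : Vec d) : ℝ := inner ℝ x (act Q x)

theorem quadForm_eq {d : ℕ} (Q : Mat d) (x : Vec d) :
    quadForm Q x = x.ofLp ⬝ᵥ (Q *ᵥ x.ofLp) := inner_eq_dotProduct _ _

theorem continuous_quadForm {d : ℕ} (Q : Mat d) : Continuous (quadForm Q) :=
  continuous_id.inner (continuous_act Q)

theorem inner_act_comm {d : ℕ} {Q : Mat d} (hQ : Q.PosDef) (x y : Vec d) :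
    inner ℝ x (act Q y) = inner ℝ y (act Q x) := by
  have hT : Qᵀ = Q := by simpa [Matrix.IsHermitian] using hQ.isHermitian
  rw [inner_eq_dotProduct, inner_eq_dotProduct, ofLp_act, ofLp_act, Matrix.dotProduct_mulVec,
    ← Matrix.mulVec_transpose, hT, dotProduct_comm]

theorem quadForm_nonneg {d : ℕ} {Q : Mat d} (hQ : Q.PosDef) (x : Vec d) : 0 ≤ quadForm Q x := by
  rw [quadForm_eq]
  simpa using hQ.posSemidef.dotProduct_mulVec_nonneg x.ofLp

theorem quadForm_le_norm {d : ℕ} (Q : Mat d) (x : Vec d) : quadForm Q x ≤ ‖Q‖ * ‖x‖ ^ 2 := by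
  calc quadForm Q x ≤ ‖x‖ * ‖act Q x‖ := real_inner_le_norm _ _
    _ ≤ ‖x‖ * (‖Q‖ * ‖x‖) := by gcongr; exact norm_act_le Q x
    _ = _ := by ring

theorem quadForm_sub_smul {d : ℕ} {Q : Mat d} (hQ : Q.PosDef) (α : ℝ) (x y : Vec d) :
    quadForm Q (x - α • y) = quadForm Q x - 2 * α * inner ℝ x (act Q y) + α ^ 2 * quadForm Q y := by
  unfold quadForm
  rw [act_sub, act_smul, inner_sub_left, inner_sub_right, inner_sub_right, inner_smul_left,
    inner_smul_left, inner_smul_right, inner_smul_right, inner_act_comm hQ y x]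
  simp only [conj_trivial]
  ring

/-- Both terms of the Lyapunov equation have the same quadratic form; this evaluates the cross term
of the mean drift exactly. -/
theorem IsLyapunovSolution.two_mul_inner {d : ℕ} {M Q : Mat d} (h : IsLyapunovSolution M Q)
    (x : Vec d) : 2 * inner ℝ x (act Q (act M x)) = ‖x‖ ^ 2 := by
  have hT : Qᵀ = Q := by simpa [Matrix.IsHermitian] using h.1.isHermitian
  have h1 : x.ofLp ⬝ᵥ ((Mᵀ * Q + Q * M) *ᵥ x.ofLp) = ‖x‖ ^ 2 := by
    rw [h.2, Matrix.one_mulVec, dotProduct_self_eq_norm_sq]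
  have h2 : x.ofLp ⬝ᵥ ((Mᵀ * Q) *ᵥ x.ofLp) = inner ℝ x (act Q (act M x)) := by
    rw [inner_act_comm h.1, inner_eq_dotProduct, ofLp_act, ofLp_act, ← Matrix.mulVec_mulVec,
      Matrix.dotProduct_mulVec x.ofLp Mᵀ, Matrix.vecMul_transpose]
  have h3 : x.ofLp ⬝ᵥ ((Q * M) *ᵥ x.ofLp) = inner ℝ x (act Q (act M x)) := by
    rw [inner_eq_dotProduct, ofLp_act, ofLp_act, ← Matrix.mulVec_mulVec]
  rw [Matrix.add_mulVec, dotProduct_add, h2, h3] at h1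
  linarith

/-! ### Comparison of the quadratic form with the Euclidean norm through the extreme eigenvalues -/

section Spectrum

variable {d : ℕ} {Q : Mat d}

theorem finite_real_spectrum (hQ : Q.PosDef) : (spectrum ℝ Q).Finite := by
  rw [hQ.isHermitian.spectrum_real_eq_range_eigenvalues]
  exact Set.finite_range _

theorem nonempty_real_spectrum (hd : 1 ≤ d) (hQ : Q.PosDef) : (spectrum ℝ Q).Nonempty := by
  rw [hQ.isHermitian.spectrum_real_eq_range_eigenvalues]
  have : Nonempty (Fin d) := ⟨⟨0, hd⟩⟩
  exact Set.range_nonempty _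

theorem sInf_spectrum_pos (hd : 1 ≤ d) (hQ : Q.PosDef) : 0 < sInf (spectrum ℝ Q) := by
  have hmem := (nonempty_real_spectrum hd hQ).csInf_mem (finite_real_spectrum hQ)
  rw [hQ.isHermitian.spectrum_real_eq_range_eigenvalues] at hmem ⊢
  obtain ⟨i, hi⟩ := hmem
  rw [← hi]
  exact hQ.eigenvalues_pos i

open scoped MatrixOrder in
theorem sInf_spectrum_mul_le (hQ : Q.PosDef) (x : Vec d) :
    sInf (spectrum ℝ Q) * ‖x‖ ^ 2 ≤ quadForm Q x := by
  have h : algebraMap ℝ (Mat d) (sInf (spectrum ℝ Q)) ≤ Q :=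
    algebraMap_le_of_le_spectrum (fun r hr => csInf_le (finite_real_spectrum hQ).bddBelow hr)
      hQ.isHermitian.isSelfAdjoint
  have h2 := (Matrix.le_iff.mp h).dotProduct_mulVec_nonneg x.ofLp
  rw [star_trivial, Matrix.sub_mulVec, dotProduct_sub, Algebra.algebraMap_eq_smul_one,
    Matrix.smul_mulVec, Matrix.one_mulVec, dotProduct_smul,
    dotProduct_self_eq_norm_sq, smul_eq_mul, ← quadForm_eq] at h2
  linarith

open scoped MatrixOrder in
theorem quadForm_le_sSup_spectrum_mul (hQ : Q.PosDef) (x : Vec d) :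
    quadForm Q x ≤ sSup (spectrum ℝ Q) * ‖x‖ ^ 2 := by
  have h : Q ≤ algebraMap ℝ (Mat d) (sSup (spectrum ℝ Q)) :=
    le_algebraMap_of_spectrum_le (fun r hr => le_csSup (finite_real_spectrum hQ).bddAbove hr)
      hQ.isHermitian.isSelfAdjoint
  have h2 := (Matrix.le_iff.mp h).dotProduct_mulVec_nonneg x.ofLp
  rw [star_trivial, Matrix.sub_mulVec, dotProduct_sub, Algebra.algebraMap_eq_smul_one,
    Matrix.smul_mulVec, Matrix.one_mulVec, dotProduct_smul,
    dotProduct_self_eq_norm_sq, smul_eq_mul, ← quadForm_eq] at h2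
  linarith

theorem sSup_spectrum_pos (hd : 1 ≤ d) (hQ : Q.PosDef) : 0 < sSup (spectrum ℝ Q) :=
  (sInf_spectrum_pos hd hQ).trans_le (csInf_le_csSup (nonempty_real_spectrum hd hQ)
    (finite_real_spectrum hQ).bddBelow (finite_real_spectrum hQ).bddAbove)

theorem condNumber_pos (hd : 1 ≤ d) (hQ : Q.PosDef) : 0 < condNumber Q :=
  div_pos (sSup_spectrum_pos hd hQ) (sInf_spectrum_pos hd hQ)

theorem sSup_spectrum_mul_sq_le (hd : 1 ≤ d) (hQ : Q.PosDef) (x : Vec d) :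
    sSup (spectrum ℝ Q) * ‖x‖ ^ 2 ≤ condNumber Q * quadForm Q x := by
  have h0 := sInf_spectrum_pos hd hQ
  calc sSup (spectrum ℝ Q) * ‖x‖ ^ 2
      = condNumber Q * (sInf (spectrum ℝ Q) * ‖x‖ ^ 2) := by
        unfold condNumber; field_simp
    _ ≤ _ := mul_le_mul_of_nonneg_left (sInf_spectrum_mul_le hQ x) (condNumber_pos hd hQ).le

end Spectrum

/-! ### Mean square contraction -/

/-- The quadratic form `xᵀ Q x` with values in `[0, ∞]`. -/
noncomputable def quadFormE {d : ℕ} (Q : Mat d) (x : Vec d) : ℝ≥0∞ := ENNReal.ofReal (quadForm Q x)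

theorem enorm_sq_eq_ofReal {d : ℕ} (x : Vec d) : ‖x‖ₑ ^ 2 = ENNReal.ofReal (‖x‖ ^ 2) := by
  rw [ENNReal.ofReal_pow (norm_nonneg _), ofReal_norm]

theorem integrable_of_ae_norm_le {d : ℕ} {Ω : Type*} [MeasurableSpace Ω] {μ : Measure Ω}
    [IsFiniteMeasure μ] {A : Ω → Mat d} (hA : Measurable A) {C : ℝ}
    (hC : ∀ᵐ ω ∂μ, ‖A ω‖ ≤ C) : Integrable A μ :=
  Integrable.of_bound hA.aestronglyMeasurable C hC

theorem integral_inner_act {d : ℕ} {Ω : Type*} [MeasurableSpace Ω] {μ : Measure Ω}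
    {A : Ω → Mat d} (hA : Integrable A μ) (Q : Mat d) (x : Vec d) :
    Integrable (fun ω => inner ℝ x (act Q (act (A ω) x))) μ ∧
    ∫ ω, inner ℝ x (act Q (act (A ω) x)) ∂μ = inner ℝ x (act Q (act (∫ ω, A ω ∂μ) x)) := by
  let l : Mat d →ₗ[ℝ] ℝ :=
    { toFun := fun M => inner ℝ x (act Q (act M x))
      map_add' := fun M N => by
        rw [← inner_add_right, ← act_add]
        congr 2
        ext i; simp [Matrix.add_mulVec]
      map_smul' := fun c M => by
        rw [RingHom.id_apply, smul_eq_mul, ← inner_smul_right, ← act_smul]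
        congr 2
        ext i; simp [Matrix.smul_mulVec] }
  exact ⟨l.toContinuousLinearMap.integrable_comp hA,
    l.toContinuousLinearMap.integral_comp_comm hA⟩

theorem integral_quadForm_le {d : ℕ} (hd : 1 ≤ d) {Ω : Type*} [MeasurableSpace Ω] {μ : Measure Ω}
    [IsProbabilityMeasure μ] {A : Ω → Mat d} (hA : Measurable A) {C : ℝ} (hC0 : 0 < C)
    (hC : ∀ᵐ ω ∂μ, ‖A ω‖ ≤ C) {Q : Mat d} (hQ : IsLyapunovSolution (∫ ω, A ω ∂μ) Q)
    {α : ℝ} (hα : 0 < α) (hα1 : α < alphaP (∫ ω, A ω ∂μ) Q C 2) (x : Vec d) :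
    Integrable (fun ω => quadForm Q (x - α • act (A ω) x)) μ ∧
    ∫ ω, quadForm Q (x - α • act (A ω) x) ∂μ ≤ (1 - rateConst Q * α / 2) * quadForm Q x := by
  have hAi := integrable_of_ae_norm_le hA hC
  obtain ⟨hl1, hl2⟩ := integral_inner_act hAi Q x
  have hkpos := condNumber_pos hd hQ.1
  have hbound : ∀ᵐ ω ∂μ, quadForm Q (act (A ω) x) ≤ condNumber Q * C ^ 2 * quadForm Q x := by
    filter_upwards [hC] with ω hω
    calc quadForm Q (act (A ω) x) ≤ sSup (spectrum ℝ Q) * ‖act (A ω) x‖ ^ 2 :=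
          quadForm_le_sSup_spectrum_mul hQ.1 _
      _ ≤ sSup (spectrum ℝ Q) * (C * ‖x‖) ^ 2 := by
          gcongr
          · exact (sSup_spectrum_pos hd hQ.1).le
          · exact (norm_act_le _ _).trans (by gcongr)
      _ = C ^ 2 * (sSup (spectrum ℝ Q) * ‖x‖ ^ 2) := by ring
      _ ≤ C ^ 2 * (condNumber Q * quadForm Q x) := by
          exact mul_le_mul_of_nonneg_left (sSup_spectrum_mul_sq_le hd hQ.1 x) (sq_nonneg C)
      _ = _ := by ring
  have hqm : Measurable fun ω => quadForm Q (act (A ω) x) :=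
    (continuous_quadForm Q).measurable.comp (measurable_act.comp (hA.prodMk measurable_const))
  have hqi : Integrable (fun ω => quadForm Q (act (A ω) x)) μ := by
    refine Integrable.of_bound hqm.aestronglyMeasurable (condNumber Q * C ^ 2 * quadForm Q x) ?_
    filter_upwards [hbound] with ω hω
    rwa [Real.norm_of_nonneg (quadForm_nonneg hQ.1 _)]
  have hqint : ∫ ω, quadForm Q (act (A ω) x) ∂μ ≤ condNumber Q * C ^ 2 * quadForm Q x := by
    simpa using integral_mono_ae hqi (integrable_const _) hbound
  have hexp : ∀ ω, quadForm Q (x - α • act (A ω) x) = quadForm Q x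
      - 2 * α * inner ℝ x (act Q (act (A ω) x)) + α ^ 2 * quadForm Q (act (A ω) x) :=
    fun ω => quadForm_sub_smul hQ.1 α x _
  have hi1 : Integrable (fun ω => quadForm Q x - 2 * α * inner ℝ x (act Q (act (A ω) x))) μ :=
    (integrable_const _).sub (hl1.const_mul _)
  have hi : Integrable (fun ω => quadForm Q (x - α • act (A ω) x)) μ := by
    simp_rw [hexp]
    exact hi1.add (hqi.const_mul _)
  have hval : ∫ ω, quadForm Q (x - α • act (A ω) x) ∂μ
      = quadForm Q x - α * ‖x‖ ^ 2 + α ^ 2 * ∫ ω, quadForm Q (act (A ω) x) ∂μ := by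
    simp_rw [hexp]
    rw [integral_add hi1 (hqi.const_mul _), integral_sub (integrable_const _) (hl1.const_mul _),
      integral_const_mul, integral_const_mul, hl2, ← hQ.two_mul_inner x]
    simp
    ring
  refine ⟨hi, ?_⟩
  rw [hval]
  have hq0 := quadForm_nonneg hQ.1 x
  have hα2 : α < rateConst Q / (2 * bQ Q C ^ 2 * (2 - 1)) := hα1.trans_le (min_le_right _ _)
  have hb : bQ Q C ^ 2 = 4 * (condNumber Q * C ^ 2) := by
    unfold bQ
    rw [mul_pow, mul_pow, Real.sq_sqrt hkpos.le]
    ring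
  -- Since b_Q² = 4κ_Q C², the step-size bound says 8ακ_Q C² < a.
  rw [hb, lt_div_iff₀ (by positivity)] at hα2
  -- This is q(x) ≤ ‖Q‖‖x‖² with 2a = ‖Q‖⁻¹; if ‖Q‖ = 0 the left side is zero by the convention on
  -- inverses.
  have hQx : 2 * rateConst Q * quadForm Q x ≤ ‖x‖ ^ 2 := by
    have h1 := quadForm_le_norm Q x
    have h2 : 0 ≤ ‖Q‖⁻¹ := by positivity
    unfold rateConst
    rcases eq_or_ne ‖Q‖ 0 with h | h
    · rw [h]; simp
    · calc 2 * (‖Q‖⁻¹ / 2) * quadForm Q x ≤ 2 * (‖Q‖⁻¹ / 2) * (‖Q‖ * ‖x‖ ^ 2) := by gcongr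
        _ = ‖x‖ ^ 2 := by field_simp
  have ha0 : 0 ≤ rateConst Q := by unfold rateConst; positivity
  have e1 : α * (2 * rateConst Q * quadForm Q x) ≤ α * ‖x‖ ^ 2 := by gcongr
  have e2 : α ^ 2 * ∫ ω, quadForm Q (act (A ω) x) ∂μ
      ≤ α ^ 2 * (condNumber Q * C ^ 2 * quadForm Q x) := by gcongr
  have e3 : α * (α * (2 * (4 * (condNumber Q * C ^ 2)) * (2 - 1))) * quadForm Q x
      ≤ α * rateConst Q * quadForm Q x := by gcongr
  have e4 : 0 ≤ α * rateConst Q * quadForm Q x := by positivity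
  -- The net change is at most (-2 + 1/8) aα q(x), which is below -aα q(x)/2.
  nlinarith

theorem lintegral_quadFormE_le {d : ℕ} (hd : 1 ≤ d) {Ω : Type*} [MeasurableSpace Ω] {μ : Measure Ω}
    [IsProbabilityMeasure μ] {A : Ω → Mat d} (hA : Measurable A) {C : ℝ} (hC0 : 0 < C)
    (hC : ∀ᵐ ω ∂μ, ‖A ω‖ ≤ C) {Q : Mat d} (hQ : IsLyapunovSolution (∫ ω, A ω ∂μ) Q)
    {α : ℝ} (hα : 0 < α) (hα1 : α < alphaP (∫ ω, A ω ∂μ) Q C 2) (x : Vec d) :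
    ∫⁻ ω, quadFormE Q (x - α • act (A ω) x) ∂μ
      ≤ ENNReal.ofReal (1 - rateConst Q * α / 2) * quadFormE Q x := by
  obtain ⟨hi, hle⟩ := integral_quadForm_le hd hA hC0 hC hQ hα hα1 x
  unfold quadFormE
  rw [← ofReal_integral_eq_lintegral_ofReal hi
    (Eventually.of_forall fun ω => quadForm_nonneg hQ.1 _),
    ← ENNReal.ofReal_mul' (quadForm_nonneg hQ.1 _)]
  exact ENNReal.ofReal_le_ofReal hle

/-- A nonnegative mean is at most the factor times a positive value of q, so the factor is
nonnegative. This matters because `ENNReal.ofReal` truncates negative numbers and would not commute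
with powers. -/
theorem one_sub_rate_nonneg {d : ℕ} (hd : 1 ≤ d) {Ω : Type*} [MeasurableSpace Ω] {μ : Measure Ω}
    [IsProbabilityMeasure μ] {A : Ω → Mat d} (hA : Measurable A) {C : ℝ} (hC0 : 0 < C)
    (hC : ∀ᵐ ω ∂μ, ‖A ω‖ ≤ C) {Q : Mat d} (hQ : IsLyapunovSolution (∫ ω, A ω ∂μ) Q)
    {α : ℝ} (hα : 0 < α) (hα1 : α < alphaP (∫ ω, A ω ∂μ) Q C 2) :
    0 ≤ 1 - rateConst Q * α / 2 := by
  let x : Vec d := EuclideanSpace.single ⟨0, hd⟩ 1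
  have hx : 0 < quadForm Q x := by
    refine lt_of_lt_of_le ?_ (sInf_spectrum_mul_le hQ.1 x)
    have := sInf_spectrum_pos hd hQ.1
    have : ‖x‖ = 1 := by simp [x]
    rw [this]
    simpa
  obtain ⟨-, hle⟩ := integral_quadForm_le hd hA hC0 hC hQ hα hα1 x
  exact nonneg_of_mul_nonneg_left
    ((integral_nonneg fun ω => quadForm_nonneg hQ.1 _).trans hle) hx

/-- If a were 0, the second bound in the minimum would be 0 and leave no admissible α. -/
theorem rateConst_pos_of_lt_alphaP {d : ℕ} {M Q : Mat d} {C α : ℝ} (hα : 0 < α)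
    (hα1 : α < alphaP M Q C 2) : 0 < rateConst Q := by
  have h0 : 0 ≤ rateConst Q := by unfold rateConst; positivity
  refine h0.lt_of_ne' fun h => ?_
  have h1 := hα1.trans_le (min_le_right _ _)
  rw [h, zero_div] at h1
  exact absurd h1 hα.le.not_gt

theorem quadFormE_le {d : ℕ} {Q : Mat d} (hd : 1 ≤ d) (hQ : Q.PosDef) (x : Vec d) :
    quadFormE Q x ≤ ENNReal.ofReal (sSup (spectrum ℝ Q)) * ‖x‖ₑ ^ 2 := by
  rw [enorm_sq_eq_ofReal, ← ENNReal.ofReal_mul (sSup_spectrum_pos hd hQ).le]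
  exact ENNReal.ofReal_le_ofReal (quadForm_le_sSup_spectrum_mul hQ x)

theorem enorm_sq_le_quadFormE {d : ℕ} {Q : Mat d} (hd : 1 ≤ d) (hQ : Q.PosDef) (x : Vec d) :
    ‖x‖ₑ ^ 2 ≤ ENNReal.ofReal (sInf (spectrum ℝ Q))⁻¹ * quadFormE Q x := by
  have h0 := sInf_spectrum_pos hd hQ
  rw [enorm_sq_eq_ofReal, quadFormE, ← ENNReal.ofReal_mul (by positivity)]
  apply ENNReal.ofReal_le_ofReal
  rw [inv_mul_eq_div, le_div_iff₀ h0, mul_comm]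
  exact sInf_spectrum_mul_le hQ x

theorem measurable_quadFormE {d : ℕ} (Q : Mat d) : Measurable (quadFormE Q) :=
  ENNReal.measurable_ofReal.comp (continuous_quadForm Q).measurable

/-! ### Limits of random variables -/

theorem tendsto_integral_comp_boundedContinuous {E Ω : Type*} [TopologicalSpace E]
    [MeasurableSpace E] [BorelSpace E] [MeasurableSpace Ω] {P : Measure Ω} [IsProbabilityMeasure P]
    {Z : ℕ → Ω → E} {Zlim : Ω → E} (hZ : ∀ n, Measurable (Z n))
    (hZt : ∀ᵐ ω ∂P, Tendsto (fun n => Z n ω) atTop (𝓝 (Zlim ω)))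
    (f : BoundedContinuousFunction E ℝ) :
    Tendsto (fun n => ∫ ω, f (Z n ω) ∂P) atTop (𝓝 (∫ ω, f (Zlim ω) ∂P)) := by
  refine tendsto_integral_of_dominated_convergence (fun _ => ‖f‖) ?_ (integrable_const _) ?_ ?_
  · exact fun n => (f.continuous.measurable.comp (hZ n)).aestronglyMeasurable
  · exact fun n => Eventually.of_forall fun ω => f.norm_coe_le_norm _
  · filter_upwards [hZt] with ω hω
    exact (f.continuous.tendsto _).comp hω

/-- Almost sure limits of sequences with the same marginal laws have the same law. -/
theorem map_eq_map_of_ae_tendsto {E Ω₁ Ω₂ : Type*} [TopologicalSpace E] [MeasurableSpace E]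
    [BorelSpace E] [HasOuterApproxClosed E] [MeasurableSpace Ω₁] [MeasurableSpace Ω₂]
    {P₁ : Measure Ω₁} {P₂ : Measure Ω₂} [IsProbabilityMeasure P₁] [IsProbabilityMeasure P₂]
    {X : ℕ → Ω₁ → E} {Y : ℕ → Ω₂ → E} {Xlim : Ω₁ → E} {Ylim : Ω₂ → E}
    (hX : ∀ n, Measurable (X n)) (hXl : Measurable Xlim) (hY : ∀ n, Measurable (Y n))
    (hYl : Measurable Ylim) (hXY : ∀ n, P₁.map (X n) = P₂.map (Y n))
    (hXt : ∀ᵐ ω ∂P₁, Tendsto (fun n => X n ω) atTop (𝓝 (Xlim ω)))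
    (hYt : ∀ᵐ ω ∂P₂, Tendsto (fun n => Y n ω) atTop (𝓝 (Ylim ω))) :
    P₁.map Xlim = P₂.map Ylim := by
  have := Measure.isProbabilityMeasure_map (μ := P₁) hXl.aemeasurable
  have := Measure.isProbabilityMeasure_map (μ := P₂) hYl.aemeasurable
  apply ext_of_forall_integral_eq_of_IsFiniteMeasure
  intro f
  have hf := f.continuous
  have h1 := tendsto_integral_comp_boundedContinuous hX hXt f
  have h2 := tendsto_integral_comp_boundedContinuous hY hYt f
  rw [integral_map hXl.aemeasurable hf.measurable.aestronglyMeasurable,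
    integral_map hYl.aemeasurable hf.measurable.aestronglyMeasurable]
  refine tendsto_nhds_unique (h1.congr fun n => ?_) h2
  rw [← integral_map (hX n).aemeasurable hf.measurable.aestronglyMeasurable, hXY,
    integral_map (hY n).aemeasurable hf.measurable.aestronglyMeasurable]

/-- A series whose terms have geometrically decaying `L²` norms converges almost surely and
in `L²`. -/
theorem exists_ae_tendsto_sum_of_eLpNorm_le {E Ω : Type*} [NormedAddCommGroup E] [CompleteSpace E]
    [MeasurableSpace E] [BorelSpace E] [SecondCountableTopology E] [MeasurableSpace Ω]
    {P : Measure Ω} {X : ℕ → Ω → E} (hX : ∀ n, Measurable (X n)) {K r : ℝ≥0∞} (hK : K ≠ ∞)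
    (hr : r < 1) (h : ∀ n, eLpNorm (X n) 2 P ≤ K * r ^ n) :
    ∃ S : Ω → E, Measurable S ∧
      (∀ᵐ ω ∂P, Tendsto (fun n => ∑ j ∈ Finset.range n, X j ω) atTop (𝓝 (S ω))) ∧
      MemLp S 2 P ∧
      Tendsto (fun n => eLpNorm (fun ω => ∑ j ∈ Finset.range n, X j ω - S ω) 2 P)
        atTop (𝓝 0) := by
  have hr' : (1 - r)⁻¹ ≠ ∞ := ENNReal.inv_ne_top.mpr (tsub_pos_of_lt hr).ne'
  set f : ℕ → Ω → E := fun n ω => ∑ j ∈ Finset.range n, X j ω with hf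
  have hfm : ∀ n, Measurable (f n) := fun n => Finset.measurable_fun_sum _ fun j _ => hX j
  have hfs : ∀ n, AEStronglyMeasurable (f n) P := fun n => (hfm n).aestronglyMeasurable
  -- The summand 2⁻ᴺ makes the Cauchy estimate strict even when the geometric bound vanishes, and
  -- keeps B summable.
  let B : ℕ → ℝ≥0∞ := fun N => K * (1 - r)⁻¹ * r ^ N + 2⁻¹ ^ N
  have hgeo : ∀ N n : ℕ, ∑ j ∈ Finset.Ico N n, r ^ j ≤ (1 - r)⁻¹ * r ^ N := by
    intro N n
    calc ∑ j ∈ Finset.Ico N n, r ^ j = r ^ N * ∑ j ∈ Finset.range (n - N), r ^ j := by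
          rw [Finset.sum_Ico_eq_sum_range, Finset.mul_sum]
          simp_rw [pow_add]
      _ ≤ r ^ N * (1 - r)⁻¹ := by
          gcongr
          rw [← ENNReal.tsum_geometric]
          exact ENNReal.sum_le_tsum _
      _ = _ := mul_comm _ _
  have hdiff : ∀ N m n : ℕ, N ≤ m → m ≤ n → eLpNorm (f n - f m) 2 P ≤ K * (1 - r)⁻¹ * r ^ N := by
    intro N m n hN hmn
    have e : f n - f m = ∑ j ∈ Finset.Ico m n, X j := by
      funext ω
      simp [hf, Finset.sum_Ico_eq_sub _ hmn]
    rw [e]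
    calc eLpNorm (∑ j ∈ Finset.Ico m n, X j) 2 P
        ≤ ∑ j ∈ Finset.Ico m n, eLpNorm (X j) 2 P :=
          eLpNorm_sum_le (fun j _ => (hX j).aestronglyMeasurable) one_le_two
      _ ≤ ∑ j ∈ Finset.Ico m n, K * r ^ j := Finset.sum_le_sum fun j _ => h j
      _ = K * ∑ j ∈ Finset.Ico m n, r ^ j := by rw [Finset.mul_sum]
      _ ≤ K * ((1 - r)⁻¹ * r ^ m) := by gcongr; exact hgeo m n
      _ ≤ K * ((1 - r)⁻¹ * r ^ N) := by
          gcongr K * (_ * ?_)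
          exact pow_le_pow_right_of_le_one' hr.le hN
      _ = _ := (mul_assoc _ _ _).symm
  have hB : ∑' N, B N ≠ ∞ := by
    rw [ENNReal.tsum_add, ENNReal.tsum_mul_left, ENNReal.tsum_geometric, ENNReal.tsum_geometric]
    refine ENNReal.add_ne_top.mpr ⟨ENNReal.mul_ne_top (ENNReal.mul_ne_top hK hr') hr', ?_⟩
    simp
  have hcau : ∀ N n m : ℕ, N ≤ n → N ≤ m → eLpNorm (f n - f m) 2 P < B N := by
    intro N n m hn hm
    have hlt : K * (1 - r)⁻¹ * r ^ N < B N := by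
      refine ENNReal.lt_add_right ?_ (by simp)
      exact ENNReal.mul_ne_top (ENNReal.mul_ne_top hK hr')
        (ENNReal.pow_ne_top (hr.trans ENNReal.one_lt_top).ne)
    refine lt_of_le_of_lt ?_ hlt
    rcases le_total m n with hmn | hmn
    · exact hdiff N m n hm hmn
    · rw [eLpNorm_sub_comm]
      exact hdiff N n m hn hmn
  obtain ⟨S, hS, hSt⟩ := measurable_limit_of_tendsto_metrizable_ae
    (fun n => (hfm n).aemeasurable)
    (Lp.ae_tendsto_of_cauchy_eLpNorm hfs one_le_two hB hcau)
  have hL2 := Lp.cauchy_tendsto_of_tendsto hfs S hB hcau hSt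
  refine ⟨S, hS, hSt, ?_, hL2⟩
  -- S is in L² because S = f n - (f n - S), with f n - S of norm below 1 for some n.
  obtain ⟨n, hn⟩ := (hL2.eventually_lt_const one_pos).exists
  have h1 : MemLp (f n - S) 2 P :=
    ⟨((hfm n).sub hS).aestronglyMeasurable, hn.trans ENNReal.one_lt_top⟩
  have h2 : MemLp (f n) 2 P := memLp_finsetSum _ fun j _ =>
    ⟨(hX j).aestronglyMeasurable, (h j).trans_lt (ENNReal.mul_lt_top hK.lt_top
      (ENNReal.pow_lt_top (hr.trans ENNReal.one_lt_top)))⟩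
  simpa using h2.sub h1

/-! ### Backward compositions of the recursion -/

/-- The random variables `p k`, `k ∈ ℕ`, are independent with law `ν`. -/
structure IsIIDLaw {E Ω : Type*} [MeasurableSpace E] [MeasurableSpace Ω] (P : Measure Ω)
    (p : ℕ → Ω → E) (ν : Measure E) : Prop where
  measurable : ∀ k, Measurable (p k)
  indep : iIndepFun p P
  law : ∀ k, P.map (p k) = ν

theorem IsIIDLaw.shift {E Ω : Type*} [MeasurableSpace E] [MeasurableSpace Ω] {P : Measure Ω}
    {p : ℕ → Ω → E} {ν : Measure E} (h : IsIIDLaw P p ν) : IsIIDLaw P (fun k => p (k + 1)) ν where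
  measurable k := h.measurable (k + 1)
  indep := h.indep.precomp (add_left_injective 1)
  law k := h.law (k + 1)

/-- Y is a function of p 1, p 2, …, hence independent of p 0. The hypothesis ranges over all
σ-algebras in order to express this dependence: it is applied to the one generated by the tail and
to the ambient one. -/
theorem IsIIDLaw.map_prodMk_head {E F Ω : Type*} [MeasurableSpace E] [mF : MeasurableSpace F]
    [mΩ : MeasurableSpace Ω] {P : Measure Ω} [IsProbabilityMeasure P]
    {p : ℕ → Ω → E} {ν : Measure E} (h : IsIIDLaw P p ν) {Y : Ω → F}
    (hY : ∀ m : MeasurableSpace Ω, (∀ k, Measurable[m] (p (k + 1))) → Measurable[m] Y) :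
    P.map (fun ω => (Y ω, p 0 ω)) = (P.map Y).prod ν := by
  have hi : iIndep (fun k => MeasurableSpace.comap (p k) inferInstance) P := h.indep.iIndep
  have h1 := indep_iSup_of_disjoint (fun k => (h.measurable k).comap_le) hi
    (S := {k | 1 ≤ k}) (T := {0}) (by simp)
  have h2 : Measurable[⨆ k ∈ {k : ℕ | 1 ≤ k}, MeasurableSpace.comap (p k) inferInstance] Y := by
    apply hY
    intro k
    refine Measurable.mono (comap_measurable _) (le_trans ?_
      (le_iSup₂ (f := fun k (_ : k ∈ {k : ℕ | 1 ≤ k}) =>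
        MeasurableSpace.comap (p k) inferInstance) (k + 1) (by simp))) le_rfl
    exact le_rfl
  have hind : IndepFun Y (p 0) P := by
    rw [IndepFun_iff_Indep]
    exact indep_of_indep_of_le_left (indep_of_indep_of_le_right h1 (by simp)) h2.comap_le
  rw [← h.law 0]
  exact (indepFun_iff_map_prod_eq_prod_map_map
    (hY mΩ fun k => h.measurable (k + 1)).aemeasurable (h.measurable 0).aemeasurable).mp hind

section Backward

variable {d : ℕ} {Ω : Type*}

/-- The composition of `n` steps of the recursion, started at `x`, in which the noise with
number `0` acts last. -/
noncomputable def backComp (α : ℝ) (x : Vec d) : ℕ → (ℕ → Ω → Mat d × Vec d) → Ω → Vec d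
  | 0, _, _ => x
  | n + 1, p, ω => lsaStep α (backComp α x n (fun k => p (k + 1)) ω) (p 0 ω)

/-- The matrix product `Γ` built from the noise sequence `p`. -/
noncomputable abbrev backMat (α : ℝ) (p : ℕ → Ω → Mat d × Vec d) (ω : Ω) (n : ℕ) : Mat d :=
  backProd α (fun k ω => (p k ω).1) ω n

/-- The definition appends factors on the right; peeling off the leftmost one leaves the product of
the shifted noise, which is independent of p 0. The later inductions rest on this. -/
theorem backMat_succ_left (α : ℝ) (p : ℕ → Ω → Mat d × Vec d) (ω : Ω) (n : ℕ) :
    backMat α p ω (n + 1) = (1 - α • (p 0 ω).1) * backMat α (fun k => p (k + 1)) ω n := by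
  induction n with
  | zero => simp [backProd]
  | succ n ih =>
    have e : backMat α p ω (n + 1 + 1) = backMat α p ω (n + 1) * (1 - α • (p (n + 1) ω).1) := rfl
    rw [e, ih, mul_assoc]
    rfl

theorem act_backMat_succ_left (α : ℝ) (p : ℕ → Ω → Mat d × Vec d) (ω : Ω) (n : ℕ) (x : Vec d) :
    act (backMat α p ω (n + 1)) x = act (backMat α (fun k => p (k + 1)) ω n) x
      - α • act (p 0 ω).1 (act (backMat α (fun k => p (k + 1)) ω n) x) := by
  rw [backMat_succ_left, act_mul, act_one_sub_smul]

theorem act_sum {ι : Type*} (M : Mat d) (s : Finset ι) (f : ι → Vec d) :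
    act M (∑ i ∈ s, f i) = ∑ i ∈ s, act M (f i) := by
  classical
  induction s using Finset.induction_on with
  | empty => ext i; simp
  | insert a s ha ih => rw [Finset.sum_insert ha, Finset.sum_insert ha, act_add, ih]

theorem backComp_eq (α : ℝ) (x : Vec d) (n : ℕ) (p : ℕ → Ω → Mat d × Vec d) (ω : Ω) :
    backComp α x n p ω = α • ∑ j ∈ Finset.range n, act (backMat α p ω j) (p j ω).2
      + act (backMat α p ω n) x := by
  induction n generalizing p with
  | zero => simp [backComp, backProd, act_one]
  | succ n ih =>
    rw [backComp, ih, lsaStep, Finset.sum_range_succ', smul_sub, ← sub_add, ← act_one_sub_smul,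
      act_add, act_smul, act_sum, ← act_mul, ← backMat_succ_left, smul_add]
    simp_rw [← act_mul, ← backMat_succ_left]
    simp only [backMat, backProd, act_one]
    abel

theorem backComp_sub (α : ℝ) (x y : Vec d) (n : ℕ) (p : ℕ → Ω → Mat d × Vec d) (ω : Ω) :
    backComp α x n p ω - backComp α y n p ω = act (backMat α p ω n) (x - y) := by
  rw [backComp_eq, backComp_eq, act_sub]
  abel

theorem backComp_zero_eq (α : ℝ) (n : ℕ) (p : ℕ → Ω → Mat d × Vec d) (ω : Ω) :
    backComp α 0 n p ω = α • ∑ j ∈ Finset.range n, act (backMat α p ω j) (p j ω).2 := by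
  rw [backComp_eq, ← smul_zero (0 : ℝ), act_smul, zero_smul, add_zero]

theorem backIter_eq_backComp (α : ℝ) (p : ℕ → Ω → Mat d × Vec d) (m : ℕ) (ω : Ω) :
    backIter α (fun k ω => (p k ω).1) (fun k ω => (p k ω).2) m ω = backComp α 0 (m + 1) p ω := by
  rw [backComp_zero_eq]
  rfl

/-- The σ-algebra is explicit so that it can be the tail σ-algebra; the starting point is a variable
so that it can be random. -/
theorem measurable_backComp (α : ℝ) (n : ℕ) (m : MeasurableSpace Ω)
    {p : ℕ → Ω → Mat d × Vec d} (hp : ∀ k, Measurable (p k)) :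
    Measurable (fun z : Ω × Vec d => backComp α z.2 n p z.1) := by
  induction n generalizing p with
  | zero => exact measurable_snd
  | succ n ih =>
    exact (measurable_lsaStep α).comp
      ((ih fun k => hp (k + 1)).prodMk ((hp 0).comp measurable_fst))

theorem measurable_act_backMat (α : ℝ) (n : ℕ) (m : MeasurableSpace Ω)
    {p : ℕ → Ω → Mat d × Vec d} (hp : ∀ k, Measurable (p k)) {g : Mat d × Vec d → Vec d}
    (hg : Measurable g) : Measurable (fun ω => act (backMat α p ω n) (g (p n ω))) := by
  induction n generalizing p with
  | zero =>
    simp only [backMat, backProd, act_one]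
    exact hg.comp (hp 0)
  | succ n ih =>
    simp_rw [act_backMat_succ_left]
    have h := ih fun k => hp (k + 1)
    exact h.sub ((measurable_act.comp ((measurable_fst.comp (hp 0)).prodMk h)).const_smul α)

end Backward

/-! ### Powers of the kernel as laws of backward compositions -/

section Laws

variable {d : ℕ} {Ω : Type*} [MeasurableSpace Ω] {P : Measure Ω} [IsProbabilityMeasure P]
  {ν : Measure (Mat d × Vec d)} [IsProbabilityMeasure ν] {α : ℝ} {p : ℕ → Ω → Mat d × Vec d}

instance (α : ℝ) : IsMarkovKernel (lsaKernel ν α) where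
  isProbabilityMeasure _ := Measure.isProbabilityMeasure_map
    ((measurable_lsaStep α).comp measurable_prodMk_left).aemeasurable

theorem map_lsaStep_prod (η : Measure (Vec d)) [SFinite η] (α : ℝ) :
    (η.prod ν).map (fun q => lsaStep α q.1 q.2) = η.bind (lsaKernel ν α) := by
  ext s hs
  rw [Measure.map_apply (measurable_lsaStep α) hs,
    Measure.prod_apply (measurable_lsaStep α hs),
    Measure.bind_apply hs (Kernel.aemeasurable _)]
  refine lintegral_congr fun θ => ?_
  change _ = ν.map (lsaStep α θ) s
  exact (Measure.map_apply (μ := ν)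
    ((measurable_lsaStep α).comp (measurable_prodMk_left (x := θ))) hs).symm

/-- The last step uses p 0, which is independent of the n earlier steps, so each step composes the
law with the kernel. -/
theorem IsIIDLaw.map_backComp (h : IsIIDLaw P p ν) (x : Vec d) (n : ℕ) :
    P.map (backComp α x n p) = (lsaKernel ν α ^ n) x := by
  induction n generalizing p with
  | zero =>
    rw [pow_zero]
    change P.map (fun _ => x) = Kernel.id x
    rw [Measure.map_const, measure_univ, one_smul, Kernel.id_apply]
  | succ n ih =>
    have hm : ∀ m : MeasurableSpace Ω, (∀ k, Measurable[m] (p (k + 1))) →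
        Measurable[m] (backComp α x n fun k => p (k + 1)) :=
      fun m hm => (measurable_backComp α n m hm).comp (measurable_id.prodMk measurable_const)
    have e : backComp α x (n + 1) p = (fun q : Vec d × (Mat d × Vec d) => lsaStep α q.1 q.2) ∘
        fun ω => (backComp α x n (fun k => p (k + 1)) ω, p 0 ω) := rfl
    rw [e, ← Measure.map_map (measurable_lsaStep α)
      ((hm _ fun k => h.measurable (k + 1)).prodMk (h.measurable 0)), h.map_prodMk_head hm,
      map_lsaStep_prod, ih h.shift, pow_succ']
    exact (Kernel.comp_apply _ _ _).symm

theorem IsIIDLaw.map_backComp_prod (h : IsIIDLaw P p ν) (η : Measure (Vec d)) [SFinite η] (n : ℕ) :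
    (P.prod η).map (fun z => backComp α z.2 n p z.1) = η.bind (lsaKernel ν α ^ n) := by
  have hm := measurable_backComp α n _ h.measurable
  ext s hs
  rw [Measure.map_apply hm hs, Measure.prod_apply_symm (hm hs),
    Measure.bind_apply hs (Kernel.aemeasurable _)]
  refine lintegral_congr fun x => ?_
  rw [← h.map_backComp x n]
  exact (Measure.map_apply (μ := P)
    (hm.comp (measurable_id.prodMk (measurable_const (a := x)))) hs).symm

theorem invariant_lsaKernel_pow {η : Measure (Vec d)} (h : (lsaKernel ν α).Invariant η) (n : ℕ) :
    (lsaKernel ν α ^ n).Invariant η := by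
  induction n with
  | zero =>
    change η.bind Kernel.id = η
    exact Measure.bind_dirac
  | succ n ih =>
    rw [pow_succ]
    exact ih.comp h

end Laws

/-! ### Mean square contraction of the recursion -/

/-- For the noise law `ν` and the step size `α`, the map `x ↦ (1 - α A) x` contracts the functional
`V`, which is comparable to the squared norm, by the factor `ρ < 1` in mean, and the noise vector
is square integrable. -/
structure MeanSquareContracting {d : ℕ} (ν : Measure (Mat d × Vec d)) (α : ℝ) (V : Vec d → ℝ≥0∞)
    (ρ c C : ℝ≥0∞) : Prop where
  measurable : Measurable V
  contract : ∀ x, ∫⁻ q, V (x - α • act q.1 x) ∂ν ≤ ρ * V x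
  enorm_sq_le : ∀ x, ‖x‖ₑ ^ 2 ≤ c * V x
  le_enorm_sq : ∀ x, V x ≤ C * ‖x‖ₑ ^ 2
  rate_lt_one : ρ < 1
  lower_ne_top : c ≠ ∞
  upper_ne_top : C ≠ ∞
  second_moment : ∫⁻ q, ‖q.2‖ₑ ^ 2 ∂ν < ∞

theorem eLpNorm_two_sq {E Ω : Type*} [NormedAddCommGroup E] [MeasurableSpace Ω] (P : Measure Ω)
    (f : Ω → E) : eLpNorm f 2 P ^ 2 = ∫⁻ ω, ‖f ω‖ₑ ^ 2 ∂P := by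
  rw [eLpNorm_eq_lintegral_rpow_enorm_toReal two_ne_zero ENNReal.ofNat_ne_top]
  simp only [ENNReal.toReal_ofNat, ENNReal.rpow_ofNat, ← ENNReal.rpow_natCast, ← ENNReal.rpow_mul]
  norm_num

section Contraction

variable {d : ℕ} {Ω : Type*} [MeasurableSpace Ω] {P : Measure Ω} [IsProbabilityMeasure P]
  {ν : Measure (Mat d × Vec d)} [IsProbabilityMeasure ν] {α : ℝ} {p : ℕ → Ω → Mat d × Vec d}
  {V : Vec d → ℝ≥0∞} {ρ c C : ℝ≥0∞}

/-- Conditionally on p 1, p 2, …, the leftmost factor contracts V by ρ in mean; the rest is the same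
statement for the shifted noise. The map g covers both the series terms (`Prod.snd`) and fixed
vectors (constants). -/
theorem MeanSquareContracting.lintegral_act_backMat_le (hV : MeanSquareContracting ν α V ρ c C)
    (h : IsIIDLaw P p ν) {g : Mat d × Vec d → Vec d} (hg : Measurable g) (n : ℕ) :
    ∫⁻ ω, V (act (backMat α p ω n) (g (p n ω))) ∂P ≤ ρ ^ n * ∫⁻ q, V (g q) ∂ν := by
  induction n generalizing p with
  | zero =>
    simp only [backMat, backProd, act_one, pow_zero, one_mul]
    rw [← h.law 0]
    exact (lintegral_map (hV.measurable.comp hg) (h.measurable 0)).ge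
  | succ n ih =>
    set Y : Ω → Vec d := fun ω => act (backMat α (fun k => p (k + 1)) ω n) (g (p (n + 1) ω)) with hY
    have hYm : ∀ m : MeasurableSpace Ω, (∀ k, Measurable[m] (p (k + 1))) → Measurable[m] Y :=
      fun m hm => measurable_act_backMat α n m hm hg
    have hYm' : Measurable Y := hYm _ fun k => h.measurable (k + 1)
    have hF : Measurable fun z : Vec d × (Mat d × Vec d) => V (z.1 - α • act z.2.1 z.1) :=
      hV.measurable.comp (measurable_fst.sub ((measurable_act.comp
        ((measurable_fst.comp measurable_snd).prodMk measurable_fst)).const_smul α))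
    calc ∫⁻ ω, V (act (backMat α p ω (n + 1)) (g (p (n + 1) ω))) ∂P
        = ∫⁻ ω, V (Y ω - α • act (p 0 ω).1 (Y ω)) ∂P := by
          simp_rw [act_backMat_succ_left]
          rfl
      _ = ∫⁻ z, V (z.1 - α • act z.2.1 z.1) ∂(P.map Y).prod ν := by
          rw [← h.map_prodMk_head hYm, lintegral_map hF (hYm'.prodMk (h.measurable 0))]
      _ = ∫⁻ y, ∫⁻ q, V (y - α • act q.1 y) ∂ν ∂P.map Y := lintegral_prod _ hF.aemeasurable
      _ ≤ ∫⁻ y, ρ * V y ∂P.map Y := lintegral_mono fun y => hV.contract y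
      _ = ρ * ∫⁻ ω, V (Y ω) ∂P := by
          rw [lintegral_const_mul _ hV.measurable, lintegral_map hV.measurable hYm']
      _ ≤ ρ * (ρ ^ n * ∫⁻ q, V (g q) ∂ν) := by gcongr; exact ih h.shift
      _ = _ := by rw [pow_succ', mul_assoc]

theorem MeanSquareContracting.lintegral_enorm_sq_le (hV : MeanSquareContracting ν α V ρ c C)
    (h : IsIIDLaw P p ν) {g : Mat d × Vec d → Vec d} (hg : Measurable g) (n : ℕ) :
    ∫⁻ ω, ‖act (backMat α p ω n) (g (p n ω))‖ₑ ^ 2 ∂P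
      ≤ c * C * ρ ^ n * ∫⁻ q, ‖g q‖ₑ ^ 2 ∂ν := by
  have hm := measurable_act_backMat α n _ h.measurable hg
  calc ∫⁻ ω, ‖act (backMat α p ω n) (g (p n ω))‖ₑ ^ 2 ∂P
      ≤ ∫⁻ ω, c * V (act (backMat α p ω n) (g (p n ω))) ∂P :=
        lintegral_mono fun ω => hV.enorm_sq_le _
    _ = c * ∫⁻ ω, V (act (backMat α p ω n) (g (p n ω))) ∂P :=
        lintegral_const_mul _ (hV.measurable.comp hm)
    _ ≤ c * (ρ ^ n * ∫⁻ q, V (g q) ∂ν) := by gcongr; exact hV.lintegral_act_backMat_le h hg n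
    _ ≤ c * (ρ ^ n * ∫⁻ q, C * ‖g q‖ₑ ^ 2 ∂ν) := by
        gcongr with q
        exact hV.le_enorm_sq _
    _ = _ := by
        rw [lintegral_const_mul _ (hg.enorm.pow_const 2)]
        ring

theorem MeanSquareContracting.eLpNorm_act_backMat_le (hV : MeanSquareContracting ν α V ρ c C)
    (h : IsIIDLaw P p ν) {g : Mat d × Vec d → Vec d} (hg : Measurable g) (n : ℕ) :
    eLpNorm (fun ω => act (backMat α p ω n) (g (p n ω))) 2 P
      ≤ (c * C * ∫⁻ q, ‖g q‖ₑ ^ 2 ∂ν) ^ (1 / 2 : ℝ) * (ρ ^ (1 / 2 : ℝ)) ^ n := by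
  rw [← ENNReal.rpow_natCast, ← ENNReal.rpow_mul, mul_comm (1 / 2 : ℝ), ENNReal.rpow_mul,
    ENNReal.rpow_natCast, ← ENNReal.mul_rpow_of_nonneg _ _ (by norm_num),
    one_div, ENNReal.le_rpow_inv_iff (by norm_num), ENNReal.rpow_ofNat, eLpNorm_two_sq]
  refine (hV.lintegral_enorm_sq_le h hg n).trans (le_of_eq ?_)
  ring

theorem MeanSquareContracting.memLp_act_backMat (hV : MeanSquareContracting ν α V ρ c C)
    (h : IsIIDLaw P p ν) {g : Mat d × Vec d → Vec d} (hg : Measurable g)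
    (hg2 : ∫⁻ q, ‖g q‖ₑ ^ 2 ∂ν < ∞) (n : ℕ) :
    MemLp (fun ω => act (backMat α p ω n) (g (p n ω))) 2 P := by
  refine ⟨(measurable_act_backMat α n _ h.measurable hg).aestronglyMeasurable,
    (ENNReal.pow_lt_top_iff.mp ?_).resolve_right two_ne_zero⟩
  rw [eLpNorm_two_sq]
  refine (hV.lintegral_enorm_sq_le h hg n).trans_lt (ENNReal.mul_lt_top ?_ hg2)
  exact ENNReal.mul_lt_top (ENNReal.mul_lt_top hV.lower_ne_top.lt_top hV.upper_ne_top.lt_top)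
    (ENNReal.pow_lt_top (hV.rate_lt_one.trans ENNReal.one_lt_top))

theorem MeanSquareContracting.memLp_backComp_zero (hV : MeanSquareContracting ν α V ρ c C)
    (h : IsIIDLaw P p ν) (n : ℕ) : MemLp (backComp α 0 n p) 2 P := by
  rw [funext (backComp_zero_eq α n p)]
  exact (memLp_finsetSum _ fun j _ =>
    hV.memLp_act_backMat h measurable_snd hV.second_moment j).const_smul α

theorem MeanSquareContracting.exists_sum_tendsto (hV : MeanSquareContracting ν α V ρ c C)
    (h : IsIIDLaw P p ν) {g : Mat d × Vec d → Vec d} (hg : Measurable g)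
    (hg2 : ∫⁻ q, ‖g q‖ₑ ^ 2 ∂ν < ∞) :
    ∃ S : Ω → Vec d, Measurable S ∧
      (∀ᵐ ω ∂P, Tendsto (fun n => ∑ j ∈ Finset.range n, act (backMat α p ω j) (g (p j ω)))
        atTop (𝓝 (S ω))) ∧
      MemLp S 2 P ∧
      Tendsto (fun n => eLpNorm (fun ω =>
        ∑ j ∈ Finset.range n, act (backMat α p ω j) (g (p j ω)) - S ω) 2 P) atTop (𝓝 0) := by
  refine exists_ae_tendsto_sum_of_eLpNorm_le
    (fun n => measurable_act_backMat α n _ h.measurable hg) ?_ ?_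
    (hV.eLpNorm_act_backMat_le h hg)
  · exact ENNReal.rpow_ne_top_of_nonneg (by norm_num)
      (ENNReal.mul_ne_top (ENNReal.mul_ne_top hV.lower_ne_top hV.upper_ne_top) hg2.ne)
  · exact ENNReal.rpow_lt_one hV.rate_lt_one (by norm_num)

/-- The terms of an almost surely convergent series tend to 0. Applied to the finitely many basis
vectors, this gives one null set valid for all x. -/
theorem MeanSquareContracting.ae_tendsto_act_backMat (hV : MeanSquareContracting ν α V ρ c C)
    (h : IsIIDLaw P p ν) :
    ∀ᵐ ω ∂P, ∀ x, Tendsto (fun n => act (backMat α p ω n) x) atTop (𝓝 0) := by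
  have hb : ∀ᵐ ω ∂P, ∀ i : Fin d, Tendsto
      (fun n => act (backMat α p ω n) (EuclideanSpace.basisFun (Fin d) ℝ i)) atTop (𝓝 0) := by
    rw [ae_all_iff]
    intro i
    obtain ⟨S, -, hS, -⟩ := hV.exists_sum_tendsto h
      (g := fun _ => EuclideanSpace.basisFun (Fin d) ℝ i) measurable_const (by simp)
    filter_upwards [hS] with ω hω
    have := (hω.comp (tendsto_add_atTop_nat 1)).sub hω
    rw [sub_self] at this
    refine this.congr fun n => ?_
    simp [Finset.sum_range_succ]
  filter_upwards [hb] with ω hω x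
  have hx := (EuclideanSpace.basisFun (Fin d) ℝ).sum_repr x
  rw [← hx]
  simp_rw [act_sum, act_smul]
  have := tendsto_finsetSum Finset.univ fun i (_ : i ∈ Finset.univ) =>
    (hω i).const_smul ((EuclideanSpace.basisFun (Fin d) ℝ).repr x i)
  simpa using this

/-- The backward compositions converge almost surely and in `L²`. -/
theorem MeanSquareContracting.exists_backComp_limit (hV : MeanSquareContracting ν α V ρ c C)
    (h : IsIIDLaw P p ν) :
    ∃ S : Ω → Vec d, Measurable S ∧
      (∀ᵐ ω ∂P, ∀ x, Tendsto (fun n => backComp α x n p ω) atTop (𝓝 (S ω))) ∧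
      MemLp S 2 P ∧
      Tendsto (fun n => eLpNorm (fun ω => backComp α 0 n p ω - S ω) 2 P) atTop (𝓝 0) := by
  obtain ⟨S, hSm, hSt, hS2, hSL⟩ := hV.exists_sum_tendsto h measurable_snd hV.second_moment
  refine ⟨fun ω => α • S ω, hSm.const_smul α, ?_, hS2.const_smul α, ?_⟩
  · filter_upwards [hSt, hV.ae_tendsto_act_backMat h] with ω h1 h2 x
    simp_rw [backComp_eq]
    simpa using (h1.const_smul α).add (h2 x)
  · have e : ∀ n, (fun ω => backComp α 0 n p ω - α • S ω) = α • fun ω =>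
        ∑ j ∈ Finset.range n, act (backMat α p ω j) (p j ω).2 - S ω := by
      intro n
      funext ω
      rw [backComp_zero_eq, Pi.smul_apply, smul_sub]
    simp_rw [e, eLpNorm_const_smul]
    simpa using ENNReal.Tendsto.const_mul hSL (Or.inr (by simp))

/-- The law of the backward limit is stationary. -/
theorem IsIIDLaw.invariant_map_limit (h : IsIIDLaw P p ν) {S : Ω → Vec d} (hS : Measurable S)
    (hSt : ∀ᵐ ω ∂P, ∀ x, Tendsto (fun n => backComp α x n p ω) atTop (𝓝 (S ω))) :
    (lsaKernel ν α).Invariant (P.map S) := by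
  have hbm : ∀ n, Measurable (backComp α 0 n p) := fun n =>
    (measurable_backComp α n _ h.measurable).comp (measurable_id.prodMk measurable_const)
  have hprod : ∀ {T : Ω → Vec d}, Measurable T →
      (P.prod ν).map (fun z => lsaStep α (T z.1) z.2) = (P.map T).bind (lsaKernel ν α) := by
    intro T hT
    have := Measure.isProbabilityMeasure_map (μ := P) hT.aemeasurable
    rw [← map_lsaStep_prod]
    conv_rhs => rw [← Measure.map_id (μ := ν)]
    rw [Measure.map_prod_map _ _ hT measurable_id, Measure.map_map (measurable_lsaStep α)
      (hT.prodMap measurable_id)]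
    rfl
  have hstep : ∀ {T : Ω → Vec d}, Measurable T →
      Measurable fun z : Ω × (Mat d × Vec d) => lsaStep α (T z.1) z.2 := fun hT =>
    (measurable_lsaStep α).comp ((hT.comp measurable_fst).prodMk measurable_snd)
  rw [Kernel.Invariant, ← hprod hS]
  -- One fresh step after n backward steps has the law of n + 1 backward steps; the former tends to
  -- a step from S, the latter to S.
  refine map_eq_map_of_ae_tendsto
    (X := fun n z => lsaStep α (backComp α 0 n p z.1) z.2)
    (Y := fun n => backComp α 0 (n + 1) p) (fun n => hstep (hbm n)) (hstep hS)
    (fun n => hbm (n + 1)) hS (fun n => ?_) ?_ ?_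
  · rw [hprod (hbm n), h.map_backComp, h.map_backComp, pow_succ']
    exact (Kernel.comp_apply _ _ _).symm
  · filter_upwards [Measure.quasiMeasurePreserving_fst.ae hSt] with z hz
    have hc : Continuous fun x => lsaStep α x z.2 := by
      unfold lsaStep
      exact continuous_id.sub (((continuous_act _).sub continuous_const).const_smul α)
    exact (hc.tendsto _).comp (hz 0)
  · filter_upwards [hSt] with ω hω
    exact (hω 0).comp (tendsto_add_atTop_nat 1)

/-- Every stationary probability measure is the law of the backward limit. -/
theorem IsIIDLaw.eq_map_limit_of_invariant (h : IsIIDLaw P p ν) {S : Ω → Vec d} (hS : Measurable S)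
    (hSt : ∀ᵐ ω ∂P, ∀ x, Tendsto (fun n => backComp α x n p ω) atTop (𝓝 (S ω)))
    {η : Measure (Vec d)} [IsProbabilityMeasure η] (hη : (lsaKernel ν α).Invariant η) :
    η = P.map S := by
  -- Start from an independent point of law η: every iterate has law η, yet the iterates converge to
  -- S whatever the start.
  have h1 : (P.prod η).map (fun z => S z.1) = η.map id := by
    refine map_eq_map_of_ae_tendsto (X := fun n z => backComp α z.2 n p z.1) (Y := fun _ => id)
      (fun n => measurable_backComp α n _ h.measurable) (hS.comp measurable_fst)
      (fun _ => measurable_id) measurable_id (fun n => ?_) ?_ ?_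
    · rw [h.map_backComp_prod, Measure.map_id]
      exact invariant_lsaKernel_pow hη n
    · filter_upwards [Measure.quasiMeasurePreserving_fst.ae hSt] with z hz
      exact hz z.2
    · exact Eventually.of_forall fun x => tendsto_const_nhds
  rw [Measure.map_id] at h1
  rw [← h1]
  have : (fun z : Ω × Vec d => S z.1) = S ∘ Prod.fst := rfl
  rw [this, ← Measure.map_map hS measurable_fst, Measure.map_fst_prod, measure_univ, one_smul]

/-- Geometric convergence to a stationary measure in the Wasserstein distance. -/
theorem MeanSquareContracting.W2_sq_le (hV : MeanSquareContracting ν α V ρ c C)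
    (h : IsIIDLaw P p ν) {η : Measure (Vec d)} [IsProbabilityMeasure η]
    (hη : (lsaKernel ν α).Invariant η) (x : Vec d) (n : ℕ) :
    W2 ((lsaKernel ν α ^ n) x) η ^ 2 ≤ c * C * ρ ^ n * ∫⁻ y, ‖y - x‖ₑ ^ 2 ∂η := by
  have hm := measurable_backComp α n _ h.measurable
  have hmx : Measurable (backComp α x n p) := hm.comp (measurable_id.prodMk measurable_const)
  have hW : W2 ((lsaKernel ν α ^ n) x) η ^ 2 = ⨅ (ζ : Measure (Vec d × Vec d))
      (_ : IsCoupling ζ ((lsaKernel ν α ^ n) x) η), ∫⁻ p, ‖p.1 - p.2‖ₑ ^ 2 ∂ζ := by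
    unfold W2
    rw [← ENNReal.rpow_natCast, ← ENNReal.rpow_mul]
    norm_num
  have hpair : Measurable fun z : Ω × Vec d => (backComp α x n p z.1, backComp α z.2 n p z.1) :=
    (hmx.comp measurable_fst).prodMk hm
  rw [hW]
  -- Synchronous coupling: starts x and y ~ η driven by the same noise.
  refine (iInf₂_le ((P.prod η).map
    fun z => (backComp α x n p z.1, backComp α z.2 n p z.1)) ⟨?fst, ?snd⟩).trans ?cost
  case fst =>
    rw [Measure.map_map measurable_fst hpair, ← h.map_backComp x n]
    have : (Prod.fst ∘ fun z : Ω × Vec d => (backComp α x n p z.1, backComp α z.2 n p z.1))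
      = backComp α x n p ∘ Prod.fst := rfl
    rw [this, ← Measure.map_map hmx measurable_fst, Measure.map_fst_prod, measure_univ, one_smul]
  case snd =>
    rw [Measure.map_map measurable_snd hpair]
    exact (h.map_backComp_prod η n).trans (invariant_lsaKernel_pow hη n)
  case cost =>
    have hF : Measurable fun z : Ω × Vec d =>
        ‖backComp α x n p z.1 - backComp α z.2 n p z.1‖ₑ ^ 2 :=
      ((hmx.comp measurable_fst).sub hm).enorm.pow_const 2
    rw [lintegral_map (by fun_prop) hpair, lintegral_prod_symm _ hF.aemeasurable,
      ← lintegral_const_mul _ (by fun_prop)]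
    refine lintegral_mono fun y => ?_
    simp_rw [backComp_sub, ← enorm_neg (y - x), neg_sub]
    simpa using hV.lintegral_enorm_sq_le h (g := fun _ => x - y) measurable_const n

end Contraction

/-! ### Consequences of the noise assumption -/

section Noise

variable {d : ℕ} {Ω : Type*} [MeasurableSpace Ω] {μ : Measure Ω}

theorem IsIID.isIIDLaw {A : ℕ → Ω → Mat d} {b : ℕ → Ω → Vec d} (h : IsIID μ A b)
    {ν : Measure (Mat d × Vec d)} (hν : μ.map (fun ω => (A 0 ω, b 0 ω)) = ν) :
    IsIIDLaw μ (fun k ω => (A k ω, b k ω)) ν where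
  measurable k := (h.measurable_A k).prodMk (h.measurable_b k)
  indep := h.indep
  law k := (h.ident k 0).map_eq.trans hν

theorem IsIID.precomp {ι κ : Type*} {A : ι → Ω → Mat d} {b : ι → Ω → Vec d} (h : IsIID μ A b)
    {f : κ → ι} (hf : Function.Injective f) :
    IsIID μ (fun k => A (f k)) (fun k => b (f k)) where
  measurable_A k := h.measurable_A (f k)
  measurable_b k := h.measurable_b (f k)
  indep := h.indep.precomp hf
  ident k l := h.ident (f k) (f l)

/-- A random vector whose directional fluctuations are sub-Gaussian is square integrable. -/
theorem memLp_two_of_hasSubgaussianMGF [IsFiniteMeasure μ] {X : Ω → Vec d} {m : Vec d} {c : ℝ≥0}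
    (h : ∀ u : Vec d, ‖u‖ = 1 → HasSubgaussianMGF (fun ω => inner ℝ u (X ω - m)) c μ) :
    MemLp X 2 μ := by
  have h1 : MemLp (fun ω => ∑ i, inner ℝ (EuclideanSpace.basisFun (Fin d) ℝ i) (X ω - m) •
      EuclideanSpace.basisFun (Fin d) ℝ i) 2 μ := by
    refine memLp_finsetSum _ fun i _ => ?_
    have hi : MemLp (fun ω => inner ℝ (EuclideanSpace.basisFun (Fin d) ℝ i) (X ω - m)) 2 μ :=
      (h _ ((EuclideanSpace.basisFun (Fin d) ℝ).norm_eq_one i)).memLp 2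
    exact (ContinuousLinearMap.toSpanSingleton ℝ
      (EuclideanSpace.basisFun (Fin d) ℝ i)).comp_memLp' hi
  simp_rw [OrthonormalBasis.sum_repr'] at h1
  refine (memLp_congr_ae (Eventually.of_forall fun ω => ?_)).mp (h1.add (memLp_const m))
  simp

theorem NoiseAssumption.meanSquareContracting [IsProbabilityMeasure μ] (hd : 1 ≤ d)
    {A : ℕ+ → Ω → Mat d} {b : ℕ+ → Ω → Vec d} {Cb CA : ℝ≥0} (hA1 : NoiseAssumption μ A b Cb CA)
    {Q : Mat d} (hQ : IsLyapunovSolution (∫ ω, A 1 ω ∂μ) Q) {α : ℝ} (hα : 0 < α)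
    (hα1 : α < alphaP (∫ ω, A 1 ω ∂μ) Q CA 2) :
    MeanSquareContracting (μ.map (fun ω => (A 1 ω, b 1 ω))) α (quadFormE Q)
      (ENNReal.ofReal (1 - rateConst Q * α / 2)) (ENNReal.ofReal (sInf (spectrum ℝ Q))⁻¹)
      (ENNReal.ofReal (sSup (spectrum ℝ Q))) where
  measurable := measurable_quadFormE Q
  contract x := by
    have hm : Measurable fun q : Mat d × Vec d => quadFormE Q (x - α • act q.1 x) :=
      (measurable_quadFormE Q).comp (measurable_const.sub
        ((measurable_act.comp (measurable_fst.prodMk measurable_const)).const_smul α))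
    rw [lintegral_map hm ((hA1.iid.measurable_A 1).prodMk (hA1.iid.measurable_b 1))]
    exact lintegral_quadFormE_le hd (hA1.iid.measurable_A 1) hA1.CA_pos hA1.bounded_A hQ hα hα1 x
  enorm_sq_le := enorm_sq_le_quadFormE hd hQ.1
  le_enorm_sq := quadFormE_le hd hQ.1
  rate_lt_one := by
    have := mul_pos (rateConst_pos_of_lt_alphaP hα hα1) hα
    rw [← ENNReal.ofReal_one, ENNReal.ofReal_lt_ofReal_iff one_pos]
    linarith
  lower_ne_top := ENNReal.ofReal_ne_top
  upper_ne_top := ENNReal.ofReal_ne_top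
  second_moment := by
    rw [lintegral_map (measurable_snd.enorm.pow_const 2)
      ((hA1.iid.measurable_A 1).prodMk (hA1.iid.measurable_b 1)), ← eLpNorm_two_sq]
    exact ENNReal.pow_lt_top (memLp_two_of_hasSubgaussianMGF hA1.subGaussian).2

end Noise

/-! ### Stationary law, Wasserstein convergence and backward limit -/

theorem theorem2 {d : ℕ} (hd : 1 ≤ d) {Ω : Type u} [MeasurableSpace Ω] (μ : Measure Ω)
    [IsProbabilityMeasure μ] (A : ℕ+ → Ω → Mat d) (b : ℕ+ → Ω → Vec d) (Cb CA : ℝ≥0)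
    (hA1 : NoiseAssumption μ A b Cb CA) :
    -- the matrix `Q`, which enters the constants, is well defined
    ∃ Q : Mat d, IsLyapunovSolution (∫ ω, A 1 ω ∂μ) Q ∧
      (∀ Q' : Mat d, IsLyapunovSolution (∫ ω, A 1 ω ∂μ) Q' → Q' = Q) ∧
      ∀ α : ℝ, 0 < α → α < alphaP (∫ ω, A 1 ω ∂μ) Q CA 2 →
        ∃ π : Measure (Vec d),
          -- `π` is in `P₂`, is stationary, and is the only stationary probability measure
          IsP2 π ∧
          (lsaKernel (μ.map (fun ω => (A 1 ω, b 1 ω))) α).Invariant π ∧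
          (∀ π' : Measure (Vec d), IsProbabilityMeasure π' →
            (lsaKernel (μ.map (fun ω => (A 1 ω, b 1 ω))) α).Invariant π' → π' = π) ∧
          -- geometric convergence in `W₂`
          (∀ (θ : Vec d) (n : ℕ),
            W2 ((lsaKernel (μ.map (fun ω => (A 1 ω, b 1 ω))) α ^ n) θ) π ^ 2 ≤
              ENNReal.ofReal (condNumber Q * d * (1 - rateConst Q * α / 2) ^ n) *
                ∫⁻ θ', ‖θ' - θ‖ₑ ^ 2 ∂π) ∧
          -- `π` is the law of the limit of the backward iteration
          (∀ (Ω' : Type v) [MeasurableSpace Ω'] (P : Measure Ω') [IsProbabilityMeasure P]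
            (A' : ℕ → Ω' → Mat d) (b' : ℕ → Ω' → Vec d), IsIID P A' b' →
            IdentDistrib (fun ω => (A' 0 ω, b' 0 ω)) (fun ω => (A 1 ω, b 1 ω)) P μ →
            ∃ θlim : Ω' → Vec d, Measurable θlim ∧
              (∀ᵐ ω ∂P, Tendsto (fun m => backIter α A' b' m ω) atTop (𝓝 (θlim ω))) ∧
              (∀ m, MemLp (backIter α A' b' m) 2 P) ∧ MemLp θlim 2 P ∧
              Tendsto (fun m => eLpNorm (fun ω => backIter α A' b' m ω - θlim ω) 2 P)
                atTop (𝓝 0) ∧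
              P.map θlim = π) := by
  obtain ⟨Q, hQ, hQu⟩ := hA1.hurwitz.exists_unique_lyapunov
  refine ⟨Q, hQ, hQu, fun α hα hα1 => ?_⟩
  have hV := hA1.meanSquareContracting hd hQ hα hα1
  have hρ := one_sub_rate_nonneg hd (hA1.iid.measurable_A 1) hA1.CA_pos hA1.bounded_A hQ hα hα1
  have hpm : Measurable fun ω => (A 1 ω, b 1 ω) :=
    (hA1.iid.measurable_A 1).prodMk (hA1.iid.measurable_b 1)
  have := Measure.isProbabilityMeasure_map (μ := μ) hpm.aemeasurable
  -- The given sequence, renumbered from 0, itself serves as backward noise: for i.i.d. variables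
  -- the direction of time is immaterial.
  have hp := (hA1.iid.precomp Nat.succPNat_injective).isIIDLaw
    (ν := μ.map (fun ω => (A 1 ω, b 1 ω))) rfl
  obtain ⟨S, hS, hSt, hS2, -⟩ := hV.exists_backComp_limit hp
  have hinv := hp.invariant_map_limit hS hSt
  have := Measure.isProbabilityMeasure_map (μ := μ) hS.aemeasurable
  refine ⟨μ.map S, ⟨inferInstance, ?_⟩, hinv, fun π' _ hπ' =>
    hp.eq_map_limit_of_invariant hS hSt hπ', fun θ n => ?_, ?_⟩
  · rw [lintegral_map (by fun_prop) hS, ← eLpNorm_two_sq]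
    exact ENNReal.pow_lt_top hS2.2
  · refine (hV.W2_sq_le hp hinv θ n).trans ?_
    gcongr
    have hs := sInf_spectrum_pos hd hQ.1
    rw [← ENNReal.ofReal_mul (by positivity), ← ENNReal.ofReal_pow hρ,
      ← ENNReal.ofReal_mul (mul_nonneg (by positivity) (sSup_spectrum_pos hd hQ.1).le)]
    apply ENNReal.ofReal_le_ofReal
    -- The two norm comparisons multiply to λ_max(Q)/λ_min(Q) = κ_Q; the factor d in the claim is
    -- then free because d ≥ 1.
    rw [inv_mul_eq_div]
    change condNumber Q * _ ≤ _
    have hk := condNumber_pos hd hQ.1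
    have hd' : (1 : ℝ) ≤ d := by exact_mod_cast hd
    gcongr
    exact le_mul_of_one_le_right hk.le hd'
  · intro Ω' _ P _ A' b' hiid hid
    have hp' := hiid.isIIDLaw hid.map_eq
    obtain ⟨T, hT, hTt, hT2, hTL⟩ := hV.exists_backComp_limit hp'
    have e : ∀ m ω, backIter α A' b' m ω
        = backComp α 0 (m + 1) (fun k ω => (A' k ω, b' k ω)) ω := fun m ω =>
      backIter_eq_backComp α (fun k ω => (A' k ω, b' k ω)) m ω
    have := Measure.isProbabilityMeasure_map (μ := P) hT.aemeasurable
    refine ⟨T, hT, ?_, fun m => ?_, hT2, ?_, ?_⟩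
    · filter_upwards [hTt] with ω hω
      simp_rw [e]
      -- The sum with indices 0, …, m is the composition of m + 1 steps, hence the shift.
      exact (hω 0).comp (tendsto_add_atTop_nat 1)
    · rw [funext (e m)]
      exact hV.memLp_backComp_zero hp' (m + 1)
    · simp_rw [e]
      exact hTL.comp (tendsto_add_atTop_nat 1)
    -- The limit on the other probability space has a stationary law, so uniqueness identifies it
    -- with π.
    · exact hp.eq_map_limit_of_invariant hS hSt (hp'.invariant_map_limit hT hTt)
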